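/- **Conventions.** $|\cdot|$ is the Euclidean norm, "smooth" means $C^\infty$, and $W$ always denotes a closed bounded (possibly empty) set. Let $g:\mathbb R\setminus W\to\mathbb R$ be smooth. It is *analytic at infinity* if there are $\epsilon_1,\epsilon_2>0$ and real $(a_n)_{n\ge1},(b_n)_{n\ge 1}$ with $g(1/x)=\sum_{n\ge1}a_nx^n$ for $0<x<\epsilon_1$ and $g(1/x)=\sum_{n\ge1}b_nx^n$ for $-\epsilon_2<x<0$, both series converging absolutely there (and $1/x\notin W$ for these $x$). A function $f:\mathbb R^d\setminus W\to\mathbb R$ is of *moderate decrease $n$* if there is $C>0$ with $|f(p)|\le C/|p|^n$ for all $p\notin W$ with $|p|>1$; for $n=1$ it is said to be of *very moderate decrease*, for $n=2$ of *moderate decrease*. Subscripts denote fixed variables, e.g. $f_x(y)=f(x,y)$ on $\{y:(x,y)\notin W\}$ and $f_{x,y}(z)=f(x,y,z)$ on $\{z:(x,y,z)\notin W\}$; zeros are counted in these domains. **Two variables.** Let $f:\mathbb R^2\setminus W\to\mathbb R$ be smooth, and consider: (a) for all $x$ and all $y$ in $\mathbb R$, $f_x$ and $f_y$ are analytic at infinity;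 (b) $f$ is of very moderate decrease; (c) $\partial f/\partial x$ and $\partial f/\partial y$ are of moderate decrease. * $f$ is *normal* if (a)–(c) hold and the numbers of zeros of $f_x,f_x',f_x''$ and $f_y,f_y',f_y''$ are bounded uniformly in $x$ and $y$. * $f$ is *quasi normal* if (a)–(c) hold and there are $K,R\in\mathbb R$ such that for $|x|>K$ the zeros of each of $f_x,f_x',f_x''$ lie in a set $(-M,-N)\cup(N,M)$ with real $N<M$, $M-N\le R$ ($M,N$ may depend on $x$ and on the function), and similarly for $f_y,f_y',f_y''$ with $|y|>K$. * $f$ is *quasi split normal* if (a)–(c) hold and there are a closed bounded $W'\supseteq W$ and (smooth) quasi normal $f_1,f_2:\mathbb R^2\setminus W'\to\mathbb R$ with $f=f_1+f_2$ on $\mathbb R^2\setminus W'$. **Three variables.** Let $f:\mathbb R^3\setminus W\to\mathbb R$ be smooth, and consider: (A) $f$ is of very moderate decrease; (B) for all $i,j,k\ge0$ with $i+j+k\ge1$, $\partial^{i+j+k}f/\partial x^i\partial y^j\partial z^k$ is of moderate decrease $i+j+k+1$; (Z) there are $K,R\in\mathbb R$ and $S\in\mathbb N$ such that for $|(x,y)|>K$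 all zeros of $f_{x,y}$ and of its first four derivatives lie in a union of $S$ bounded intervals of total length at most $R$, and similarly for $f_{x,z}$ and $f_{y,z}$. * $f$ is *normal* if (A), (B) hold, every $f_x(y,z)$, $f_y(x,z)$, $f_z(x,y)$ is normal, and the numbers of zeros of $f_{x,y},f_{x,z},f_{y,z}$ and of their first four derivatives are bounded uniformly in the fixed variables. * $f$ is *quasi normal* if (A), (B), (Z) hold and every $f_x$, $f_y$, $f_z$ is quasi normal. * $f$ is *quasi split normal* if (A), (B) hold, every $f_x$, $f_y$, $f_z$ is quasi split normal, and there are a closed bounded $W'\supseteq W$ and smooth $f_1,f_2:\mathbb R^3\setminus W'\to\mathbb R$ satisfying (Z) with $f=f_1+f_2$ on $\mathbb R^3\setminus W'$. **Lemma.** 1. Let $(a,b,c)\in\mathbb R^3$, $s>0$ and let $W$ be the closed ball of radius $s$ around $(a,b,c)$. Then $f(x,y,z)=\dfrac1{|(x,y,z)-(a,b,c)|}$, restricted to $\mathbb R^3\setminus W$, is normal. 2. Let $\rho:\mathbb R^3\to\mathbb R$ be continuous with compact support, $\rho\ge0$, $\rho\ne0$. Then the integral $$f(x,y,z)=\int_{\mathbb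 R^3}\frac{\rho(x',y',z')}{|(x,y,z)-(x',y',z')|}\,dx'dy'dz'$$ converges absolutely at every point of $\mathbb R^3$, and $f$ is quasi normal off the support of $\rho$, in the sense that for every closed bounded $W$ whose interior contains $\operatorname{Supp}(\rho)$ the restriction of $f$ to $\mathbb R^3\setminus W$ is quasi normal. 3. Let $\rho:\mathbb R^3\to\mathbb R$ be smooth with compact support, $\rho\ne0$. Then the same integral converges absolutely at every point and $f:\mathbb R^3\to\mathbb R$ is quasi split normal (with $W=\emptyset$). -/

import Mathlib

open scoped ContDiff

namespace Normality

noncomputable section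

/-- `ℝ^d` with the Euclidean norm. -/
abbrev Rn (d : ℕ) : Type := EuclideanSpace ℝ (Fin d)

/-- The real number `c` as a point of `ℝ^1`. -/
def pt (c : ℝ) : Rn 1 := WithLp.toLp 2 ![c]

/-- The point of `ℝ^(d+1)` whose `i`-th coordinate is `t` and whose remaining coordinates are,
in order, those of `q`. -/
def ins {d : ℕ} (i : Fin (d + 1)) (t : ℝ) (q : Rn d) : Rn (d + 1) :=
  WithLp.toLp 2 (i.insertNth t q.ofLp)

/-! A function `f : ℝ^d ∖ W → ℝ` is represented by a total function `f` together with the set `W`;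
every condition below only concerns the values of `f` off `W` (where `W` is closed, so that
derivatives at points off `W` only depend on these values too). -/

/-- `|f p| ≤ C / |p| ^ n` for all `p` in the domain with `|p| > 1`.  The case `n = 1` is
very moderate decrease, the case `n = 2` is moderate decrease. -/
def ModerateDecrease {d : ℕ} (n : ℕ) (W : Set (Rn d)) (f : Rn d → ℝ) : Prop :=
  ∃ C : ℝ, 0 < C ∧ ∀ p : Rn d, p ∉ W → 1 < ‖p‖ → |f p| ≤ C / ‖p‖ ^ n

/-- The partial derivative with respect to the `i`-th coordinate. -/
def pderiv {d : ℕ} (i : Fin d) (f : Rn d → ℝ) : Rn d → ℝ :=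
  fun p => lineDeriv ℝ f p (EuclideanSpace.single i (1 : ℝ))

/-- A smooth function `g : ℝ ∖ W → ℝ`, with `W` closed and bounded, is analytic at infinity: for
small `x > 0`, and for small `x < 0`, `g (1 / x)` is the sum of an (absolutely) convergent power
series `∑_{n ≥ 1} aₙ xⁿ`.  (`HasSum` in `ℝ` is unconditional, hence absolute, convergence.) -/
structure AnalyticAtInfinity (W : Set ℝ) (g : ℝ → ℝ) : Prop where
  isClosed : IsClosed W
  isBounded : Bornology.IsBounded W
  smooth : ContDiffOn ℝ ∞ g Wᶜ
  pos : ∃ ε : ℝ, 0 < ε ∧ ∃ a : ℕ → ℝ, ∀ x : ℝ, 0 < x → x < ε →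
    1 / x ∉ W ∧ HasSum (fun n : ℕ => a n * x ^ (n + 1)) (g (1 / x))
  neg : ∃ ε : ℝ, 0 < ε ∧ ∃ b : ℕ → ℝ, ∀ x : ℝ, -ε < x → x < 0 →
    1 / x ∉ W ∧ HasSum (fun n : ℕ => b n * x ^ (n + 1)) (g (1 / x))

/-- The zeros of the `k`-th derivative of `g : ℝ ∖ W → ℝ`. -/
def zeros (W : Set ℝ) (g : ℝ → ℝ) (k : ℕ) : Set ℝ :=
  {t | t ∉ W ∧ iteratedDeriv k g t = 0}

/-- The function of one variable obtained by letting the `i`-th coordinate vary and fixing the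
other ones to be those of `q`. -/
def line {d : ℕ} (i : Fin (d + 1)) (q : Rn d) (f : Rn (d + 1) → ℝ) : ℝ → ℝ :=
  fun t => f (ins i t q)

/-- The corresponding section of the excluded set. -/
def lineSet {d : ℕ} (i : Fin (d + 1)) (q : Rn d) (W : Set (Rn (d + 1))) : Set ℝ :=
  {t | ins i t q ∈ W}

/-- The function obtained by fixing the `i`-th coordinate to be `c`. -/
def slice {d : ℕ} (i : Fin (d + 1)) (c : ℝ) (f : Rn (d + 1) → ℝ) : Rn d → ℝ :=
  fun q => f (ins i c q)

/-- The corresponding section of the excluded set. -/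
def sliceSet {d : ℕ} (i : Fin (d + 1)) (c : ℝ) (W : Set (Rn (d + 1))) : Set (Rn d) :=
  {q | ins i c q ∈ W}

/-! ### Two variables -/

/-- The conditions common to the three notions of normality in two variables: `f` is smooth on
`ℝ² ∖ W` with `W` closed and bounded, all the functions `f_x` and `f_y` are analytic at infinity,
`f` is of very moderate decrease and its first partial derivatives are of moderate decrease.
In `line i (pt c) f` the `i`-th coordinate varies and the other one is fixed to be `c`. -/
structure Base2 (W : Set (Rn 2)) (f : Rn 2 → ℝ) : Prop where
  isClosed : IsClosed W
  isBounded : Bornology.IsBounded W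
  smooth : ContDiffOn ℝ ∞ f Wᶜ
  analytic : ∀ (i : Fin 2) (c : ℝ), AnalyticAtInfinity (lineSet i (pt c) W) (line i (pt c) f)
  decrease : ModerateDecrease 1 W f
  decrease_pderiv : ∀ i : Fin 2, ModerateDecrease 2 W (pderiv i f)

/-- `f : ℝ² ∖ W → ℝ` is normal: moreover the number of zeros of `f_x, f_x', f_x''` and of
`f_y, f_y', f_y''` is uniformly bounded. -/
structure Normal2 (W : Set (Rn 2)) (f : Rn 2 → ℝ) : Prop extends Base2 W f where
  zeros_le : ∃ val : ℕ, ∀ (i : Fin 2) (c : ℝ), ∀ k ≤ 2,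
    (zeros (lineSet i (pt c) W) (line i (pt c) f) k).encard ≤ val

/-- `f : ℝ² ∖ W → ℝ` is quasi normal: for sufficiently large `x`, the zeros of each of
`f_x, f_x', f_x''` are contained in a union `(-M, -N) ∪ (N, M)` with `M - N` bounded uniformly
in `x`, and similarly for `f_y, f_y', f_y''`. -/
structure QuasiNormal2 (W : Set (Rn 2)) (f : Rn 2 → ℝ) : Prop extends Base2 W f where
  zeros_subset : ∃ K R : ℝ, ∀ (i : Fin 2) (c : ℝ), K < |c| → ∀ k ≤ 2, ∃ M N : ℝ,
    N < M ∧ M - N ≤ R ∧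
      zeros (lineSet i (pt c) W) (line i (pt c) f) k ⊆ Set.Ioo (-M) (-N) ∪ Set.Ioo N M

/-- `f : ℝ² ∖ W → ℝ` is quasi split normal: off some larger closed bounded set, `f` is the sum of
two (smooth) quasi normal functions. -/
structure QuasiSplitNormal2 (W : Set (Rn 2)) (f : Rn 2 → ℝ) : Prop extends Base2 W f where
  split : ∃ (W' : Set (Rn 2)) (f₁ f₂ : Rn 2 → ℝ), W ⊆ W' ∧
    QuasiNormal2 W' f₁ ∧ QuasiNormal2 W' f₂ ∧ ∀ p ∉ W', f p = f₁ p + f₂ p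

/-! ### Three variables -/

/-- The conditions common to the three notions of normality in three variables: `f` is smooth on
`ℝ³ ∖ W` with `W` closed and bounded, `f` is of very moderate decrease, and each partial derivative
`∂^(i+j+k) f / ∂x^i ∂y^j ∂z^k` with `i + j + k ≥ 1` is of moderate decrease `i + j + k + 1`. -/
structure Base3 (W : Set (Rn 3)) (f : Rn 3 → ℝ) : Prop where
  isClosed : IsClosed W
  isBounded : Bornology.IsBounded W
  smooth : ContDiffOn ℝ ∞ f Wᶜ
  decrease : ModerateDecrease 1 W f
  decrease_pderiv : ∀ i j k : ℕ, 1 ≤ i + j + k →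
    ModerateDecrease (i + j + k + 1) W ((pderiv 0)^[i] ((pderiv 1)^[j] ((pderiv 2)^[k] f)))

/-- `f : ℝ³ ∖ W → ℝ` is normal. -/
structure Normal3 (W : Set (Rn 3)) (f : Rn 3 → ℝ) : Prop extends Base3 W f where
  slice_normal : ∀ (i : Fin 3) (c : ℝ), Normal2 (sliceSet i c W) (slice i c f)
  zeros_le : ∃ val : ℕ, ∀ (i : Fin 3) (q : Rn 2), ∀ k ≤ 4,
    (zeros (lineSet i q W) (line i q f) k).encard ≤ val

/-- For sufficiently large `(x, y)`, the zeros of `f_{x,y}` and of its first four derivatives are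
contained in a union of `S` bounded intervals of total length at most `R`, with `S` and `R`
independent of `(x, y)`; and similarly for `f_{x,z}` and `f_{y,z}`. -/
def ZerosInIntervals (W : Set (Rn 3)) (f : Rn 3 → ℝ) : Prop :=
  ∃ (K R : ℝ) (S : ℕ), ∀ (i : Fin 3) (q : Rn 2), K < ‖q‖ → ∃ a b : Fin S → ℝ,
    (∀ m, a m ≤ b m) ∧ ∑ m, (b m - a m) ≤ R ∧
      ∀ k ≤ 4, zeros (lineSet i q W) (line i q f) k ⊆ ⋃ m, Set.Icc (a m) (b m)

/-- `f : ℝ³ ∖ W → ℝ` is quasi normal. -/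
structure QuasiNormal3 (W : Set (Rn 3)) (f : Rn 3 → ℝ) : Prop extends Base3 W f where
  slice_quasiNormal : ∀ (i : Fin 3) (c : ℝ), QuasiNormal2 (sliceSet i c W) (slice i c f)
  zeros_subset : ZerosInIntervals W f

/-- `f : ℝ³ ∖ W → ℝ` is quasi split normal; the last condition says that off some larger closed
bounded set `f` is the sum of two smooth functions whose zeros lie in intervals as above. -/
structure QuasiSplitNormal3 (W : Set (Rn 3)) (f : Rn 3 → ℝ) : Prop extends Base3 W f where
  slice_quasiSplitNormal : ∀ (i : Fin 3) (c : ℝ),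
    QuasiSplitNormal2 (sliceSet i c W) (slice i c f)
  split : ∃ (W' : Set (Rn 3)) (f₁ f₂ : Rn 3 → ℝ), W ⊆ W' ∧ IsClosed W' ∧
    Bornology.IsBounded W' ∧ ContDiffOn ℝ ∞ f₁ W'ᶜ ∧ ContDiffOn ℝ ∞ f₂ W'ᶜ ∧
    ZerosInIntervals W' f₁ ∧ ZerosInIntervals W' f₂ ∧ ∀ p ∉ W', f p = f₁ p + f₂ p

/-- The Newtonian potential `∫ ρ(p') / |p - p'| dp'` of a density on `ℝ³`. -/
def potential (ρ : Rn 3 → ℝ) : Rn 3 → ℝ :=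
  fun p => ∫ p' : Rn 3, ρ p' / ‖p - p'‖

end

end Normality

/-!
A point charge and a continuous charge distribution are both a compactly supported source, and their
potentials are its convolution with the kernel `v ↦ 1 / |v|`. Off the source one may differentiate
under the integral; the partial derivatives of the kernel of order `n` are homogeneous of degree
`-(n + 1)`, which gives the decay. For a unit vector `e`, inversion turns `1 / |p + e / x - b|` into
`|x| / |e + x (p - b)|`, and `|e + x v|²` is a polynomial in `x` close to `1` for small complex `x`,
so that its power `-1 / 2` extends holomorphically, uniformly in `b`. This is the analyticity
at infinity.

In direction `i`, the `k`-th derivative of the kernel at distance `|w|` from the axis vanishes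
exactly on finitely many cones `t = α |w|`, where `α` runs through the roots of a polynomial of
degree `k`. This settles point charges. For a charge of constant sign inside a ball of radius `r`,
the mean value theorem for integrals shows that each zero on the line over `q` is a zero for some
point charge in the ball, hence lies within `(1 + |α|) r` of some `α |q|`; for `k ≤ 2` the roots are
`± A` for a single `A`. A charge of arbitrary sign is the sum of `2 |ρ| + ρ ≥ 0` and `-2 |ρ| ≤ 0`.
-/

namespace Normality

open MeasureTheory Metric Set
open ContinuousLinearMap (lsmul)
open scoped Convolution RealInnerProductSpace

noncomputable section

/-! ### Integrals against compactly supported densities -/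

/-- `ρ` is a density with respect to `ν` whose mass lies in the compact set `S`. A charge
distribution on `S` and, with `ν` a Dirac mass, a point charge are both of this form. -/
structure IsSource {X F : Type*} [TopologicalSpace X] [MeasurableSpace X] [NormedAddCommGroup F]
    (ν : Measure X) (S : Set X) (ρ : X → F) : Prop where
  isCompact : IsCompact S
  integrable : Integrable ρ ν
  ae_mem : ∀ᵐ a ∂ν, ρ a ≠ 0 → a ∈ S

theorem norm_smul_le_of_ne_zero_imp {𝕜 F : Type*} [NormedDivisionRing 𝕜] [NormedAddCommGroup F]
    [Module 𝕜 F] [NormSMulClass 𝕜 F] {c : 𝕜} {y : F} {B : ℝ} (h : c ≠ 0 → ‖y‖ ≤ B) :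
    ‖c • y‖ ≤ ‖c‖ * B := by
  rw [norm_smul]
  rcases eq_or_ne c 0 with rfl | hc
  · simp
  · exact mul_le_mul_of_nonneg_left (h hc) (norm_nonneg c)

namespace IsSource

section Parametric

variable {X 𝕜 F : Type*} [TopologicalSpace X] [T2Space X] [MeasurableSpace X]
  [OpensMeasurableSpace X] [RCLike 𝕜] [NormedAddCommGroup F] [NormedSpace 𝕜 F]
  {ν : Measure X} {S : Set X} {ρ : X → 𝕜}

theorem integrable_smul (h : IsSource ν S ρ) {φ : X → F} (hφ : ContinuousOn φ S) :
    Integrable (fun a => ρ a • φ a) ν := by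
  obtain ⟨B, hB⟩ := h.isCompact.exists_bound_of_continuousOn hφ
  have hS : MeasurableSet S := h.isCompact.measurableSet
  have hint : IntegrableOn (fun a => ρ a • φ a) S ν :=
    h.integrable.integrableOn.smul_bdd B (hφ.aestronglyMeasurable_of_isCompact h.isCompact hS)
      (ae_restrict_of_forall_mem hS hB)
  refine hint.integrable_of_ae_notMem_eq_zero ?_
  filter_upwards [h.ae_mem] with a ha haS
  rw [not_imp_comm.1 ha haS, zero_smul]

theorem hasFDerivAt_integral_smul [NormedSpace ℝ F] {H : Type*} [NormedAddCommGroup H]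
    [NormedSpace 𝕜 H] [LocallyCompactSpace H] (h : IsSource ν S ρ) {U : Set H} (hU : IsOpen U)
    {Φ : H → X → F} {Φ' : H → X → H →L[𝕜] F} (hΦ : ∀ x ∈ U, ContinuousOn (Φ x) S)
    (hΦ' : ContinuousOn (fun z : H × X => Φ' z.1 z.2) (U ×ˢ S))
    (hd : ∀ x ∈ U, ∀ a ∈ S, HasFDerivAt (fun y => Φ y a) (Φ' x a) x) {x₀ : H} (hx₀ : x₀ ∈ U) :
    HasFDerivAt (fun x => ∫ a, ρ a • Φ x a ∂ν) (∫ a, ρ a • Φ' x₀ a ∂ν) x₀ := by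
  obtain ⟨K, hK, hKU, hKc⟩ := local_compact_nhds (hU.mem_nhds hx₀)
  obtain ⟨B, hB⟩ := (hKc.prod h.isCompact).exists_bound_of_continuousOn
    (hΦ'.mono (prod_mono hKU subset_rfl))
  have hΦ'₀ : ContinuousOn (Φ' x₀) S :=
    hΦ'.comp (f := fun a => (x₀, a)) (by fun_prop) (fun a ha => ⟨hx₀, ha⟩)
  refine hasFDerivAt_integral_of_dominated_of_fderiv_le (bound := fun a => ‖ρ a‖ * B)
    (F' := fun x a => ρ a • Φ' x a) hK ?_ (h.integrable_smul (hΦ x₀ hx₀))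
    (h.integrable_smul hΦ'₀).aestronglyMeasurable ?_ (h.integrable.norm.mul_const B) ?_
  · filter_upwards [hK] with x hx
    exact (h.integrable_smul (hΦ x (hKU hx))).aestronglyMeasurable
  · filter_upwards [h.ae_mem] with a ha x hx
    exact norm_smul_le_of_ne_zero_imp fun hρ => hB (x, a) ⟨hx, ha hρ⟩
  · filter_upwards [h.ae_mem] with a ha x hx
    by_cases hρ : ρ a = 0
    · simpa [hρ] using hasFDerivAt_const (0 : F) x
    · exact (hd x (hKU hx) a (ha hρ)).const_smul (ρ a)

end Parametric

end IsSource

/-! ### Convolution with a kernel that is singular at the origin -/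

section Kernel

variable {E F : Type*} [NormedAddCommGroup E] {S : Set E} {φ : E → F}

theorem sub_ne_zero_of_notMem_of_mem {p a : E} (hp : p ∉ S) (ha : a ∈ S) : p - a ≠ 0 :=
  fun h => hp (by rwa [sub_eq_zero.1 h])

theorem continuousOn_comp_const_sub [TopologicalSpace F] (hφ : ContinuousOn φ {0}ᶜ) {p : E}
    (hp : p ∉ S) : ContinuousOn (fun a => φ (p - a)) S :=
  hφ.comp (by fun_prop) fun _ ha => sub_ne_zero_of_notMem_of_mem hp ha

variable [NormedSpace ℝ E] [NormedAddCommGroup F] [NormedSpace ℝ F]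

theorem differentiableAt_of_contDiffOn_compl_zero (hφ : ContDiffOn ℝ ∞ φ {0}ᶜ) {v : E}
    (hv : v ≠ 0) : DifferentiableAt ℝ φ v :=
  (hφ.differentiableOn (by simp)).differentiableAt (isOpen_compl_singleton.mem_nhds hv)

theorem contDiffOn_fderiv_compl_zero (hφ : ContDiffOn ℝ ∞ φ {0}ᶜ) :
    ContDiffOn ℝ ∞ (fderiv ℝ φ) {0}ᶜ :=
  ((contDiffOn_infty_iff_fderiv_of_isOpen isOpen_compl_singleton).1 hφ).2

end Kernel

namespace IsSource

universe u

theorem convolutionExistsAt {E F : Type*} [NormedAddCommGroup E] [MeasurableSpace E]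
    [OpensMeasurableSpace E] [NormedAddCommGroup F] [NormedSpace ℝ F] {ν : Measure E} {S : Set E}
    {ρ : E → ℝ} {φ : E → F} (h : IsSource ν S ρ) (hφ : ContinuousOn φ {0}ᶜ) {p : E}
    (hp : p ∉ S) : ConvolutionExistsAt ρ φ p (lsmul ℝ ℝ) ν :=
  h.integrable_smul (continuousOn_comp_const_sub hφ hp)

variable {E F : Type u} [NormedAddCommGroup E] [NormedSpace ℝ E] [LocallyCompactSpace E]
  [MeasurableSpace E] [OpensMeasurableSpace E] [NormedAddCommGroup F] [NormedSpace ℝ F]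
  {ν : Measure E} {S : Set E} {ρ : E → ℝ} {φ : E → F}

theorem hasFDerivAt_convolution (h : IsSource ν S ρ) (hφ : ContDiffOn ℝ ∞ φ {0}ᶜ) {p : E}
    (hp : p ∉ S) :
    HasFDerivAt (ρ ⋆[lsmul ℝ ℝ, ν] φ) ((ρ ⋆[lsmul ℝ ℝ, ν] fderiv ℝ φ) p) p := by
  refine h.hasFDerivAt_integral_smul h.isCompact.isClosed.isOpen_compl
    (Φ := fun p a => φ (p - a)) (Φ' := fun p a => fderiv ℝ φ (p - a))
    (fun x hx => continuousOn_comp_const_sub hφ.continuousOn hx) ?_ ?_ hp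
  · exact (contDiffOn_fderiv_compl_zero hφ).continuousOn.comp (f := fun z : E × E => z.1 - z.2)
      (by fun_prop) fun z hz => sub_ne_zero_of_notMem_of_mem hz.1 hz.2
  · intro x hx a ha
    have hd := differentiableAt_of_contDiffOn_compl_zero hφ (sub_ne_zero_of_notMem_of_mem hx ha)
    exact hd.hasFDerivAt.comp x ((hasFDerivAt_id x).sub_const a)

theorem contDiffOn_convolution (h : IsSource ν S ρ) (hφ : ContDiffOn ℝ ∞ φ {0}ᶜ) :
    ContDiffOn ℝ ∞ (ρ ⋆[lsmul ℝ ℝ, ν] φ) Sᶜ := by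
  refine contDiffOn_infty.2 fun n => ?_
  induction n generalizing F with
  | zero =>
    exact contDiffOn_zero.2 fun p hp =>
      (h.hasFDerivAt_convolution hφ hp).continuousAt.continuousWithinAt
  | succ n ih =>
    have hd (p : E) (hp : p ∈ Sᶜ) := h.hasFDerivAt_convolution hφ hp
    push_cast
    refine (contDiffOn_succ_iff_fderiv_of_isOpen h.isCompact.isClosed.isOpen_compl).2
      ⟨fun p hp => (hd p hp).differentiableAt.differentiableWithinAt, by simp, ?_⟩
    exact (ih (contDiffOn_fderiv_compl_zero hφ)).congr fun p hp => (hd p hp).fderiv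

theorem lineDeriv_convolution (h : IsSource ν S ρ) (hφ : ContDiffOn ℝ ∞ φ {0}ᶜ) (v : E) :
    EqOn (fun p => lineDeriv ℝ (ρ ⋆[lsmul ℝ ℝ, ν] φ) p v)
      (ρ ⋆[lsmul ℝ ℝ, ν] fun p => lineDeriv ℝ φ p v) Sᶜ := by
  intro p hp
  have hd := h.hasFDerivAt_convolution hφ hp
  have hint := h.convolutionExistsAt (contDiffOn_fderiv_compl_zero hφ).continuousOn hp
  simp only [hd.differentiableAt.lineDeriv_eq_fderiv, hd.fderiv]
  rw [convolution_def, ContinuousLinearMap.integral_apply hint]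
  refine integral_congr_ae ?_
  filter_upwards [h.ae_mem] with a ha
  by_cases hρ : ρ a = 0
  · simp [hρ]
  · have hφa := differentiableAt_of_contDiffOn_compl_zero hφ
      (sub_ne_zero_of_notMem_of_mem hp (ha hρ))
    rw [hφa.lineDeriv_eq_fderiv]
    rfl

end IsSource

/-! ### Partial derivatives -/

section Pderiv

variable {d : ℕ} {f g : Rn d → ℝ} {U : Set (Rn d)}

theorem contDiffOn_pderiv (hU : IsOpen U) (hf : ContDiffOn ℝ ∞ f U) (i : Fin d) :
    ContDiffOn ℝ ∞ (pderiv i f) U := by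
  obtain ⟨hdiff, hfderiv⟩ := (contDiffOn_infty_iff_fderiv_of_isOpen hU).1 hf
  exact (hfderiv.clm_apply contDiffOn_const).congr fun p hp =>
    (hdiff.differentiableAt (hU.mem_nhds hp)).lineDeriv_eq_fderiv

theorem contDiffOn_pderiv_iterate (hU : IsOpen U) (hf : ContDiffOn ℝ ∞ f U) (i : Fin d) (n : ℕ) :
    ContDiffOn ℝ ∞ ((pderiv i)^[n] f) U := by
  induction n with
  | zero => exact hf
  | succ n ih =>
    rw [Function.iterate_succ_apply']
    exact contDiffOn_pderiv hU ih i

theorem eqOn_pderiv (hU : IsOpen U) (hfg : EqOn f g U) (i : Fin d) :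
    EqOn (pderiv i f) (pderiv i g) U := fun _ hp =>
  (hfg.eventuallyEq_of_mem (hU.mem_nhds hp)).lineDeriv_eq

theorem eqOn_pderiv_iterate (hU : IsOpen U) (hfg : EqOn f g U) (i : Fin d) (n : ℕ) :
    EqOn ((pderiv i)^[n] f) ((pderiv i)^[n] g) U := by
  induction n with
  | zero => exact hfg
  | succ n ih =>
    simp only [Function.iterate_succ_apply']
    exact eqOn_pderiv hU ih i

theorem IsSource.pderiv_iterate_convolution {ν : Measure (Rn d)} {S : Set (Rn d)}
    {ρ φ : Rn d → ℝ} (h : IsSource ν S ρ) (hφ : ContDiffOn ℝ ∞ φ {0}ᶜ) (i : Fin d) (n : ℕ) :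
    EqOn ((pderiv i)^[n] (ρ ⋆[lsmul ℝ ℝ, ν] φ)) (ρ ⋆[lsmul ℝ ℝ, ν] (pderiv i)^[n] φ) Sᶜ := by
  induction n with
  | zero => exact eqOn_refl _ _
  | succ n ih =>
    simp only [Function.iterate_succ_apply']
    exact (eqOn_pderiv h.isCompact.isClosed.isOpen_compl ih i).trans
      (h.lineDeriv_convolution (contDiffOn_pderiv_iterate isOpen_compl_singleton hφ i n) _)

end Pderiv

/-! ### Decay of convolutions with homogeneous kernels -/

/-- `φ` is positively homogeneous of degree `-m`. -/
def IsHomogeneousNeg {E F : Type*} [AddCommGroup E] [Module ℝ E] [AddCommGroup F] [Module ℝ F]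
    (m : ℕ) (φ : E → F) : Prop :=
  ∀ s : ℝ, 0 < s → ∀ v : E, φ (s • v) = (s ^ m)⁻¹ • φ v

namespace IsHomogeneousNeg

variable {E F : Type*} [NormedAddCommGroup F] [NormedSpace ℝ F] {m : ℕ}

theorem lineDeriv [AddCommGroup E] [Module ℝ E] {φ : E → F} (hφ : IsHomogeneousNeg m φ) (w : E) :
    IsHomogeneousNeg (m + 1) (fun p => lineDeriv ℝ φ p w) := by
  intro s hs v
  have hline : (fun t : ℝ => φ (s • v + t • w)) = fun t => (s ^ m)⁻¹ • φ (v + (s⁻¹ * t) • w) := by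
    funext t
    rw [← hφ s hs, smul_add, smul_smul, mul_inv_cancel_left₀ hs.ne']
  simp only [_root_.lineDeriv]
  rw [hline, deriv_fun_const_smul_field, deriv_comp_mul_left s⁻¹ (fun t => φ (v + t • w)) 0,
    mul_zero, smul_smul, pow_succ, mul_inv]

theorem pderiv_iterate {d : ℕ} {φ : Rn d → ℝ} (hφ : IsHomogeneousNeg m φ) (i : Fin d) (n : ℕ) :
    IsHomogeneousNeg (m + n) ((pderiv i)^[n] φ) := by
  induction n with
  | zero => exact hφ
  | succ n ih =>
    rw [Function.iterate_succ_apply']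
    exact ih.lineDeriv _

theorem exists_norm_le [NormedAddCommGroup E] [NormedSpace ℝ E] [ProperSpace E] {φ : E → F}
    (hφ : IsHomogeneousNeg m φ) (hc : ContinuousOn φ {0}ᶜ) :
    ∃ C : ℝ, 0 ≤ C ∧ ∀ v ≠ 0, ‖φ v‖ ≤ C / ‖v‖ ^ m := by
  have hsphere : sphere (0 : E) 1 ⊆ {0}ᶜ := fun v hv hv0 =>
    ne_zero_of_mem_unit_sphere ⟨v, hv⟩ hv0
  obtain ⟨C, hC⟩ := (isCompact_sphere (0 : E) 1).exists_bound_of_continuousOn (hc.mono hsphere)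
  refine ⟨max C 0, le_max_right _ _, fun v hv => ?_⟩
  have hv₀ : 0 < ‖v‖ := norm_pos_iff.2 hv
  have hunit : ‖φ (‖v‖⁻¹ • v)‖ ≤ C := hC _ (by simpa using norm_smul_inv_norm (𝕜 := ℝ) hv)
  calc ‖φ v‖ = ‖φ (‖v‖ • ‖v‖⁻¹ • v)‖ := by rw [smul_inv_smul₀ hv₀.ne']
    _ = (‖v‖ ^ m)⁻¹ * ‖φ (‖v‖⁻¹ • v)‖ := by
        rw [hφ _ hv₀, norm_smul, Real.norm_of_nonneg (by positivity)]
    _ ≤ (‖v‖ ^ m)⁻¹ * max C 0 := by gcongr; exact hunit.trans (le_max_left _ _)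
    _ = max C 0 / ‖v‖ ^ m := by rw [div_eq_mul_inv, mul_comm]

end IsHomogeneousNeg

theorem exists_norm_le_mul_norm_sub {E : Type*} [NormedAddCommGroup E] {S W : Set E}
    (hS : IsCompact S) (hW : S ⊆ interior W) :
    ∃ A : ℝ, 0 < A ∧ ∀ p ∉ W, ∀ a ∈ S, ‖p‖ ≤ A * ‖p - a‖ := by
  obtain ⟨δ, hδ, hδW⟩ := hS.exists_cthickening_subset_open isOpen_interior hW
  obtain ⟨r, hr, hrS⟩ := hS.isBounded.exists_pos_norm_le
  refine ⟨1 + r / δ, by positivity, fun p hp a ha => ?_⟩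
  have hfar : δ ≤ ‖p - a‖ := by
    by_contra! hlt
    refine hp (interior_subset (hδW (mem_cthickening_of_dist_le p a δ S ha ?_)))
    rw [dist_eq_norm]
    exact hlt.le
  calc ‖p‖ ≤ ‖p - a‖ + ‖a‖ := by simpa using norm_add_le (p - a) a
    _ ≤ ‖p - a‖ + r / δ * δ := by rw [div_mul_cancel₀ r hδ.ne']; gcongr; exact hrS a ha
    _ ≤ ‖p - a‖ + r / δ * ‖p - a‖ := by gcongr
    _ = (1 + r / δ) * ‖p - a‖ := by ring

theorem ModerateDecrease.congr {d n : ℕ} {W : Set (Rn d)} {f g : Rn d → ℝ}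
    (hg : ModerateDecrease n W g) (hfg : EqOn f g Wᶜ) : ModerateDecrease n W f := by
  obtain ⟨C, hC, hCg⟩ := hg
  exact ⟨C, hC, fun p hp hp₁ => hfg hp ▸ hCg p hp hp₁⟩

theorem IsSource.moderateDecrease_convolution {d m : ℕ} {ν : Measure (Rn d)} {S W : Set (Rn d)}
    {ρ φ : Rn d → ℝ} (h : IsSource ν S ρ) (hW : S ⊆ interior W) (hφ : IsHomogeneousNeg m φ)
    (hc : ContinuousOn φ {0}ᶜ) : ModerateDecrease m W (ρ ⋆[lsmul ℝ ℝ, ν] φ) := by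
  obtain ⟨A, hA, hAW⟩ := exists_norm_le_mul_norm_sub h.isCompact hW
  obtain ⟨C, hC, hCφ⟩ := hφ.exists_norm_le hc
  have hmass : 0 ≤ ∫ a, ‖ρ a‖ ∂ν := integral_nonneg fun _ => norm_nonneg _
  refine ⟨(∫ a, ‖ρ a‖ ∂ν) * (C * A ^ m) + 1, by positivity, fun p hp hp₁ => ?_⟩
  have hp₀ : 0 < ‖p‖ := by linarith
  have hpS : p ∉ S := fun hs => hp (interior_subset (hW hs))
  have hkernel (a : Rn d) (ha : a ∈ S) : ‖φ (p - a)‖ ≤ C * A ^ m / ‖p‖ ^ m := by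
    have hpa : p - a ≠ 0 := sub_ne_zero_of_notMem_of_mem hpS ha
    refine (hCφ _ hpa).trans ?_
    rw [div_le_div_iff₀ (by positivity) (by positivity), mul_assoc, ← mul_pow]
    gcongr
    exact hAW p hp a ha
  calc |(ρ ⋆[lsmul ℝ ℝ, ν] φ) p| ≤ ∫ a, ‖ρ a‖ * (C * A ^ m / ‖p‖ ^ m) ∂ν := by
        rw [convolution_lsmul, ← Real.norm_eq_abs]
        refine norm_integral_le_of_norm_le (h.integrable.norm.mul_const _) ?_
        filter_upwards [h.ae_mem] with a ha
        exact norm_smul_le_of_ne_zero_imp fun hρ => hkernel a (ha hρ)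
    _ = (∫ a, ‖ρ a‖ ∂ν) * (C * A ^ m) / ‖p‖ ^ m := by rw [integral_mul_const, ← mul_div_assoc]
    _ ≤ ((∫ a, ‖ρ a‖ ∂ν) * (C * A ^ m) + 1) / ‖p‖ ^ m := by gcongr; linarith

/-! ### The Newtonian kernel -/

/-- The kernel `1 / |v|`, which in dimension three is the Newtonian one. -/
def invNorm {E : Type*} [Norm E] : E → ℝ := fun v => ‖v‖⁻¹

theorem isHomogeneousNeg_invNorm {E : Type*} [NormedAddCommGroup E] [NormedSpace ℝ E] :
    IsHomogeneousNeg 1 (invNorm (E := E)) := by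
  intro s hs v
  simp only [invNorm, norm_smul, Real.norm_of_nonneg hs.le, mul_inv, pow_one, smul_eq_mul]

theorem contDiffOn_invNorm {E : Type*} [NormedAddCommGroup E] [InnerProductSpace ℝ E] :
    ContDiffOn ℝ ∞ (invNorm (E := E)) {0}ᶜ := fun _ hv =>
  ((contDiffAt_norm ℝ hv).inv (norm_ne_zero_iff.2 hv)).contDiffWithinAt

theorem potential_eq_convolution (ρ : Rn 3 → ℝ) :
    potential ρ = ρ ⋆[lsmul ℝ ℝ, volume] invNorm := rfl

theorem IsSource.base3_convolution {ν : Measure (Rn 3)} {S W : Set (Rn 3)} {ρ : Rn 3 → ℝ}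
    (h : IsSource ν S ρ) (hWc : IsClosed W) (hWb : Bornology.IsBounded W) (hW : S ⊆ interior W) :
    Base3 W (ρ ⋆[lsmul ℝ ℝ, ν] invNorm) where
  isClosed := hWc
  isBounded := hWb
  smooth := (h.contDiffOn_convolution contDiffOn_invNorm).mono
    (compl_subset_compl.2 (hW.trans interior_subset))
  decrease := h.moderateDecrease_convolution hW isHomogeneousNeg_invNorm
    contDiffOn_invNorm.continuousOn
  decrease_pderiv i j k _ := by
    have hS : IsOpen Sᶜ := h.isCompact.isClosed.isOpen_compl
    have h₂ := contDiffOn_pderiv_iterate isOpen_compl_singleton contDiffOn_invNorm (2 : Fin 3) k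
    have h₁ := contDiffOn_pderiv_iterate isOpen_compl_singleton h₂ 1 j
    have h₀ := contDiffOn_pderiv_iterate isOpen_compl_singleton h₁ 0 i
    have hcongr := (eqOn_pderiv_iterate hS ((eqOn_pderiv_iterate hS
      (h.pderiv_iterate_convolution contDiffOn_invNorm 2 k) 1 j).trans
      (h.pderiv_iterate_convolution h₂ 1 j)) 0 i).trans (h.pderiv_iterate_convolution h₁ 0 i)
    have hdeg := ((isHomogeneousNeg_invNorm.pderiv_iterate (2 : Fin 3) k).pderiv_iterate
      1 j).pderiv_iterate 0 i
    rw [show 1 + k + j + i = i + j + k + 1 by ring] at hdeg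
    exact (h.moderateDecrease_convolution hW hdeg h₀.continuousOn).congr
      (hcongr.mono (compl_subset_compl.2 (hW.trans interior_subset)))

/-! ### Lines and slices -/

section Ins

variable {d : ℕ}

@[simp]
theorem ins_apply_same (i : Fin (d + 1)) (t : ℝ) (q : Rn d) : ins i t q i = t := by
  simp [ins]

@[simp]
theorem ins_apply_succAbove (i : Fin (d + 1)) (t : ℝ) (q : Rn d) (j : Fin d) :
    ins i t q (i.succAbove j) = q j := by
  simp [ins]

theorem ext_succAbove (i : Fin (d + 1)) {p p' : Rn (d + 1)} (hi : p i = p' i)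
    (hj : ∀ j : Fin d, p (i.succAbove j) = p' (i.succAbove j)) : p = p' := by
  ext l
  rcases Fin.eq_self_or_eq_succAbove i l with rfl | ⟨j, rfl⟩
  exacts [hi, hj j]

theorem exists_eq_ins (i : Fin (d + 1)) (p : Rn (d + 1)) : ∃ q : Rn d, p = ins i (p i) q :=
  ⟨WithLp.toLp 2 fun j => p (i.succAbove j), ext_succAbove i (by simp) (by simp)⟩

theorem ins_sub_ins (i : Fin (d + 1)) (t s : ℝ) (q r : Rn d) :
    ins i t q - ins i s r = ins i (t - s) (q - r) :=
  ext_succAbove i (by simp) (by simp)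

theorem ins_add_smul_single (i : Fin (d + 1)) (t s : ℝ) (q : Rn d) :
    ins i t q + s • EuclideanSpace.single i (1 : ℝ) = ins i (t + s) q :=
  ext_succAbove i (by simp) (by simp)

theorem ins_add_smul_single_succAbove (i : Fin (d + 1)) (t s : ℝ) (q : Rn d) (j : Fin d) :
    ins i t q + s • EuclideanSpace.single (i.succAbove j) (1 : ℝ) =
      ins i t (q + s • EuclideanSpace.single j (1 : ℝ)) :=
  ext_succAbove i (by simp [Fin.ne_succAbove]) (by simp)

theorem norm_ins_sq (i : Fin (d + 1)) (t : ℝ) (q : Rn d) :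
    ‖ins i t q‖ ^ 2 = t ^ 2 + ‖q‖ ^ 2 := by
  simp [EuclideanSpace.norm_sq_eq, Fin.sum_univ_succAbove _ i]

theorem abs_le_norm_ins (i : Fin (d + 1)) (t : ℝ) (q : Rn d) : |t| ≤ ‖ins i t q‖ :=
  abs_le_of_sq_le_sq (by nlinarith [norm_ins_sq i t q, sq_nonneg ‖q‖]) (norm_nonneg _)

theorem norm_le_norm_ins (i : Fin (d + 1)) (t : ℝ) (q : Rn d) : ‖q‖ ≤ ‖ins i t q‖ :=
  le_of_sq_le_sq (by nlinarith [norm_ins_sq i t q, sq_nonneg t]) (norm_nonneg _)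

theorem contDiff_ins {G : Type*} [NormedAddCommGroup G] [NormedSpace ℝ G] {n : WithTop ℕ∞}
    (i : Fin (d + 1)) {t : G → ℝ} {q : G → Rn d} (ht : ContDiff ℝ n t) (hq : ContDiff ℝ n q) :
    ContDiff ℝ n fun x => ins i (t x) (q x) := by
  rw [contDiff_euclidean] at hq ⊢
  intro l
  rcases Fin.eq_self_or_eq_succAbove i l with rfl | ⟨j, rfl⟩
  · simpa only [ins_apply_same] using ht
  · simpa only [ins_apply_succAbove] using hq j

theorem contDiff_ins_left (i : Fin (d + 1)) (q : Rn d) : ContDiff ℝ ∞ fun t => ins i t q :=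
  contDiff_ins i contDiff_id contDiff_const

theorem contDiff_ins_right (i : Fin (d + 1)) (t : ℝ) : ContDiff ℝ ∞ (ins (d := d) i t) :=
  contDiff_ins i contDiff_const contDiff_id

theorem iteratedDeriv_line (i : Fin (d + 1)) (q : Rn d) (f : Rn (d + 1) → ℝ) (k : ℕ) :
    iteratedDeriv k (line i q f) = line i q ((pderiv i)^[k] f) := by
  induction k with
  | zero => rw [iteratedDeriv_zero, Function.iterate_zero_apply]
  | succ k ih =>
    rw [iteratedDeriv_succ, ih, Function.iterate_succ_apply']
    funext t
    have hshift := deriv_comp_const_add (line i q ((pderiv i)^[k] f)) t 0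
    rw [add_zero] at hshift
    rw [← hshift]
    simp only [line, pderiv, lineDeriv, ins_add_smul_single]

theorem pderiv_slice (i : Fin (d + 1)) (c : ℝ) (f : Rn (d + 1) → ℝ) (j : Fin d) :
    pderiv j (slice i c f) = slice i c (pderiv (i.succAbove j) f) := by
  funext q
  simp only [pderiv, slice, lineDeriv, ins_add_smul_single_succAbove]

variable {W : Set (Rn (d + 1))} {f : Rn (d + 1) → ℝ}

theorem isClosed_lineSet (i : Fin (d + 1)) (q : Rn d) (hW : IsClosed W) :
    IsClosed (lineSet i q W) :=
  hW.preimage (contDiff_ins_left i q).continuous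

theorem isClosed_sliceSet (i : Fin (d + 1)) (c : ℝ) (hW : IsClosed W) :
    IsClosed (sliceSet i c W) :=
  hW.preimage (contDiff_ins_right i c).continuous

theorem isBounded_lineSet (i : Fin (d + 1)) (q : Rn d) (hW : Bornology.IsBounded W) :
    Bornology.IsBounded (lineSet i q W) := by
  obtain ⟨C, hC⟩ := hW.exists_norm_le
  exact isBounded_iff_forall_norm_le.2 ⟨C, fun t ht => (abs_le_norm_ins i t q).trans (hC _ ht)⟩

theorem isBounded_sliceSet (i : Fin (d + 1)) (c : ℝ) (hW : Bornology.IsBounded W) :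
    Bornology.IsBounded (sliceSet i c W) := by
  obtain ⟨C, hC⟩ := hW.exists_norm_le
  exact isBounded_iff_forall_norm_le.2 ⟨C, fun q hq => (norm_le_norm_ins i c q).trans (hC _ hq)⟩

theorem contDiffOn_line (i : Fin (d + 1)) (q : Rn d) (hf : ContDiffOn ℝ ∞ f Wᶜ) :
    ContDiffOn ℝ ∞ (line i q f) (lineSet i q W)ᶜ :=
  hf.comp (contDiff_ins_left i q).contDiffOn fun _ ht => ht

theorem contDiffOn_slice (i : Fin (d + 1)) (c : ℝ) (hf : ContDiffOn ℝ ∞ f Wᶜ) :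
    ContDiffOn ℝ ∞ (slice i c f) (sliceSet i c W)ᶜ :=
  hf.comp (contDiff_ins_right i c).contDiffOn fun _ hq => hq

theorem ModerateDecrease.slice {n : ℕ} (h : ModerateDecrease n W f) (i : Fin (d + 1)) (c : ℝ) :
    ModerateDecrease n (sliceSet i c W) (slice i c f) := by
  obtain ⟨C, hC, hCf⟩ := h
  refine ⟨C, hC, fun q hq hq₁ => ?_⟩
  have hle := norm_le_norm_ins i c q
  have hq₀ : 0 < ‖q‖ := by linarith
  calc |f (ins i c q)| ≤ C / ‖ins i c q‖ ^ n := hCf _ hq (hq₁.trans_le hle)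
    _ ≤ C / ‖q‖ ^ n := by gcongr

theorem exists_ins_ins_eq (i : Fin (d + 2)) (j : Fin (d + 1)) (c : ℝ) (q : Rn d) :
    ∃ r : Rn (d + 1), ‖r‖ ^ 2 = c ^ 2 + ‖q‖ ^ 2 ∧
      ∀ t, ins i c (ins j t q) = ins (i.succAbove j) t r := by
  obtain ⟨r, hr⟩ := exists_eq_ins (i.succAbove j) (ins i c (ins j 0 q))
  rw [ins_apply_succAbove, ins_apply_same] at hr
  refine ⟨r, ?_, fun t => ?_⟩
  · have hsq := congrArg (‖·‖ ^ 2) hr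
    simpa [norm_ins_sq] using hsq.symm
  · have hshift := congrArg (· + t • EuclideanSpace.single (i.succAbove j) (1 : ℝ)) hr
    simpa only [ins_add_smul_single_succAbove, ins_add_smul_single, zero_add] using hshift

theorem exists_line_slice_eq (i : Fin (d + 2)) (j : Fin (d + 1)) (c : ℝ) (q : Rn d) :
    ∃ r : Rn (d + 1), ‖r‖ ^ 2 = c ^ 2 + ‖q‖ ^ 2 ∧
      (∀ f, line j q (slice i c f) = line (i.succAbove j) r f) ∧
      ∀ W, lineSet j q (sliceSet i c W) = lineSet (i.succAbove j) r W := by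
  obtain ⟨r, hnorm, hr⟩ := exists_ins_ins_eq i j c q
  exact ⟨r, hnorm, fun f => funext fun t => congrArg f (hr t),
    fun W => Set.ext fun t => (congrArg (· ∈ W) (hr t)).to_iff⟩

end Ins

theorem Base3.moderateDecrease_pderiv {W : Set (Rn 3)} {f : Rn 3 → ℝ} (h : Base3 W f)
    (i : Fin 3) : ModerateDecrease 2 W (pderiv i f) := by
  fin_cases i
  · exact h.decrease_pderiv 1 0 0 le_rfl
  · exact h.decrease_pderiv 0 1 0 le_rfl
  · exact h.decrease_pderiv 0 0 1 le_rfl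

theorem Base3.base2_slice {W : Set (Rn 3)} {f : Rn 3 → ℝ} (h : Base3 W f)
    (ha : ∀ (i : Fin 3) (q : Rn 2), AnalyticAtInfinity (lineSet i q W) (line i q f))
    (i : Fin 3) (c : ℝ) : Base2 (sliceSet i c W) (slice i c f) where
  isClosed := isClosed_sliceSet i c h.isClosed
  isBounded := isBounded_sliceSet i c h.isBounded
  smooth := contDiffOn_slice i c h.smooth
  analytic j e := by
    obtain ⟨r, -, hline, hlineSet⟩ := exists_line_slice_eq i j c (pt e)
    rw [hline, hlineSet]
    exact ha _ r
  decrease := h.decrease.slice i c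
  decrease_pderiv j := by
    rw [pderiv_slice]
    exact (h.moderateDecrease_pderiv _).slice i c

/-! ### Expansion at infinity -/

section Inversion

variable {E : Type*} [NormedAddCommGroup E] [NormedSpace ℝ E]

theorem inv_norm_add_inv_smul (e v : E) {x : ℝ} (hx : x ≠ 0) :
    ‖v + x⁻¹ • e‖⁻¹ = |x| * ‖e + x • v‖⁻¹ := by
  have hscale : v + x⁻¹ • e = x⁻¹ • (e + x • v) := by
    rw [smul_add, inv_smul_smul₀ hx, add_comm]
  rw [hscale, norm_smul, mul_inv, norm_inv, inv_inv, Real.norm_eq_abs]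

theorem convolution_invNorm_add_inv_smul [MeasurableSpace E] (ν : Measure E) (ρ : E → ℝ) (p e : E)
    {x : ℝ} (hx : x ≠ 0) : (ρ ⋆[lsmul ℝ ℝ, ν] invNorm) (p + x⁻¹ • e) =
      |x| * ∫ b, ρ b * ‖e + x • (p - b)‖⁻¹ ∂ν := by
  rw [convolution_lsmul, ← integral_const_mul]
  congr with b
  rw [invNorm, add_sub_right_comm, inv_norm_add_inv_smul e (p - b) hx, smul_eq_mul, mul_left_comm]

end Inversion

section ComplexNormSq

variable {E : Type*} [NormedAddCommGroup E] [InnerProductSpace ℝ E]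

/-- The holomorphic extension in `x` of the squared norm `‖e + x • v‖ ^ 2`. -/
def complexNormSq (e v : E) (z : ℂ) : ℂ := ‖e‖ ^ 2 + 2 * ⟪e, v⟫ * z + ‖v‖ ^ 2 * z ^ 2

theorem complexNormSq_ofReal (e v : E) (x : ℝ) :
    complexNormSq e v x = ((‖e + x • v‖ ^ 2 : ℝ) : ℂ) := by
  rw [norm_add_sq_real, inner_smul_right, norm_smul, mul_pow, Real.norm_eq_abs, sq_abs,
    complexNormSq]
  push_cast
  ring

theorem complexNormSq_ofReal_cpow_neg_half (e v : E) (x : ℝ) :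
    complexNormSq e v x ^ (-(1 / 2) : ℂ) = ((‖e + x • v‖⁻¹ : ℝ) : ℂ) := by
  have hinv : ‖e + x • v‖⁻¹ = (‖e + x • v‖ ^ 2) ^ (-(1 / 2) : ℝ) := by
    rw [← Real.rpow_natCast, ← Real.rpow_mul (norm_nonneg _), ← Real.rpow_neg_one]
    norm_num
  rw [hinv, Complex.ofReal_cpow (sq_nonneg _), complexNormSq_ofReal]
  push_cast
  rfl

theorem complexNormSq_mem_slitPlane {e v : E} (he : ‖e‖ = 1) {z : ℂ} (hz : ‖z‖ * ‖v‖ < 1 / 4) :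
    complexNormSq e v z ∈ Complex.slitPlane := by
  have hlin : ‖(2 * ⟪e, v⟫ * z : ℂ)‖ ≤ 2 * (‖z‖ * ‖v‖) := by
    have hinner := abs_real_inner_le_norm e v
    rw [he, one_mul] at hinner
    calc ‖(2 * ⟪e, v⟫ * z : ℂ)‖ = 2 * (‖z‖ * |⟪e, v⟫|) := by
          simp only [norm_mul, Complex.norm_ofNat, Complex.norm_real, Real.norm_eq_abs]
          ring
      _ ≤ 2 * (‖z‖ * ‖v‖) := by gcongr
  have hquad : ‖(‖v‖ ^ 2 * z ^ 2 : ℂ)‖ = (‖z‖ * ‖v‖) ^ 2 := by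
    simp only [norm_mul, norm_pow, Complex.norm_real, norm_norm]
    ring
  have hsmall : ‖(2 * ⟪e, v⟫ * z + ‖v‖ ^ 2 * z ^ 2 : ℂ)‖ < 1 := by
    have hnonneg : 0 ≤ ‖z‖ * ‖v‖ := by positivity
    calc _ ≤ 2 * (‖z‖ * ‖v‖) + (‖z‖ * ‖v‖) ^ 2 :=
          (norm_add_le _ _).trans (add_le_add hlin hquad.le)
      _ < 1 := by nlinarith
  have hone : complexNormSq e v z = 1 + (2 * ⟪e, v⟫ * z + ‖v‖ ^ 2 * z ^ 2) := by
    rw [complexNormSq, he, Complex.ofReal_one, one_pow, add_assoc]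
  rw [hone]
  exact Complex.mem_slitPlane_of_norm_lt_one hsmall

theorem hasDerivAt_complexNormSq (e v : E) (z : ℂ) :
    HasDerivAt (complexNormSq e v) (2 * ⟪e, v⟫ + ‖v‖ ^ 2 * (2 * z)) z := by
  have hlin := ((hasDerivAt_id z).const_mul (2 * ⟪e, v⟫ : ℂ)).const_add (‖e‖ ^ 2 : ℂ)
  have hquad := (hasDerivAt_pow 2 z).const_mul (‖v‖ ^ 2 : ℂ)
  exact (hlin.add hquad).congr_deriv (by simp)

@[fun_prop]
theorem continuous_complexNormSq {X : Type*} [TopologicalSpace X] (e : E) {v : X → E} {z : X → ℂ}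
    (hv : Continuous v) (hz : Continuous z) : Continuous fun x => complexNormSq e (v x) (z x) := by
  unfold complexNormSq
  fun_prop

end ComplexNormSq

namespace IsSource

theorem ofReal {X : Type*} [TopologicalSpace X] [MeasurableSpace X] {ν : Measure X} {S : Set X}
    {ρ : X → ℝ} (h : IsSource ν S ρ) : IsSource ν S (fun a => (ρ a : ℂ)) where
  isCompact := h.isCompact
  integrable := h.integrable.ofReal
  ae_mem := by simpa only [ne_eq, Complex.ofReal_eq_zero] using h.ae_mem

theorem differentiableOn_integral_smul {X 𝕜 F : Type*} [TopologicalSpace X] [T2Space X]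
    [MeasurableSpace X] [OpensMeasurableSpace X] [RCLike 𝕜] [NormedAddCommGroup F]
    [NormedSpace 𝕜 F] [NormedSpace ℝ F] {ν : Measure X} {S : Set X} {ρ : X → 𝕜}
    (h : IsSource ν S ρ) {U : Set 𝕜} (hU : IsOpen U) {Φ Φ' : 𝕜 → X → F}
    (hΦ : ∀ z ∈ U, ContinuousOn (Φ z) S)
    (hΦ' : ContinuousOn (fun y : 𝕜 × X => Φ' y.1 y.2) (U ×ˢ S))
    (hd : ∀ z ∈ U, ∀ a ∈ S, HasDerivAt (fun w => Φ w a) (Φ' z a) z) :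
    DifferentiableOn 𝕜 (fun z => ∫ a, ρ a • Φ z a ∂ν) U := by
  intro z hz
  have hΦ'CLM : ContinuousOn
      (fun y : 𝕜 × X => ContinuousLinearMap.toSpanSingleton 𝕜 (Φ' y.1 y.2)) (U ×ˢ S) :=
    (ContinuousLinearMap.toSpanSingletonCLE (𝕜 := 𝕜) (E := F)).continuous.comp_continuousOn hΦ'
  exact (h.hasFDerivAt_integral_smul hU hΦ hΦ'CLM
    (fun z hz a ha => (hd z hz a ha).hasFDerivAt) hz).differentiableAt.differentiableWithinAt

section Expansion

variable {E : Type*} [NormedAddCommGroup E] [InnerProductSpace ℝ E] [MeasurableSpace E]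
  [OpensMeasurableSpace E] {ν : Measure E} {S : Set E} {ρ : E → ℝ}

theorem analyticAt_integral_complexNormSq_cpow (h : IsSource ν S ρ) {e : E} (he : ‖e‖ = 1)
    (p : E) (s : ℂ) :
    AnalyticAt ℂ (fun z => ∫ b, (ρ b : ℂ) • complexNormSq e (p - b) z ^ s ∂ν) 0 := by
  obtain ⟨B, hB, hBS⟩ := (h.isCompact.image (continuous_const.sub continuous_id :
    Continuous fun b => p - b)).isBounded.exists_pos_norm_le
  have hslit : ∀ z ∈ ball (0 : ℂ) (1 / (4 * B)), ∀ b ∈ S,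
      complexNormSq e (p - b) z ∈ Complex.slitPlane := by
    intro z hz b hb
    rw [mem_ball_zero_iff, lt_div_iff₀ (by positivity)] at hz
    refine complexNormSq_mem_slitPlane he ?_
    calc ‖z‖ * ‖p - b‖ ≤ ‖z‖ * B := by gcongr; exact hBS _ ⟨b, hb, rfl⟩
      _ < 1 / 4 := by linarith
  have hpow (s : ℂ) : ContinuousOn (fun y : ℂ × E => complexNormSq e (p - y.2) y.1 ^ s)
      (ball 0 (1 / (4 * B)) ×ˢ S) :=
    ContinuousOn.cpow_const (by fun_prop) fun y hy => hslit y.1 hy.1 y.2 hy.2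
  refine (h.ofReal.differentiableOn_integral_smul isOpen_ball ?_ ?_ fun z hz b hb =>
    (hasDerivAt_complexNormSq e (p - b) z).cpow_const (hslit z hz b hb)).analyticAt
    (ball_mem_nhds 0 (by positivity))
  · exact fun z hz => (hpow s).comp (f := fun b => (z, b)) (by fun_prop) fun b hb => ⟨hz, hb⟩
  · exact (continuousOn_const.mul (hpow (s - 1))).mul (by fun_prop)

theorem analyticAt_integral_inv_norm_add_smul (h : IsSource ν S ρ) {e : E} (he : ‖e‖ = 1)
    (p : E) : AnalyticAt ℝ (fun x : ℝ => ∫ b, ρ b * ‖e + x • (p - b)‖⁻¹ ∂ν) 0 := by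
  have hre := (h.analyticAt_integral_complexNormSq_cpow he p (-(1 / 2))).re_ofReal
  simpa only [complexNormSq_ofReal_cpow_neg_half, smul_eq_mul, ← Complex.ofReal_mul,
    integral_complex_ofReal, Complex.ofReal_re] using hre

end Expansion

end IsSource

theorem analyticAtInfinity_of_analyticAt {W : Set ℝ} {g h : ℝ → ℝ} (hWc : IsClosed W)
    (hWb : Bornology.IsBounded W) (hg : ContDiffOn ℝ ∞ g Wᶜ) (hh : AnalyticAt ℝ h 0)
    (hgh : ∀ x ≠ 0, g x⁻¹ = |x| * h x) : AnalyticAtInfinity W g := by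
  obtain ⟨P, hP⟩ := hh
  obtain ⟨ε, hε, hεP⟩ := eventually_nhds_iff_ball.1 (hasFPowerSeriesAt_iff.1 hP)
  obtain ⟨r, hr, hrW⟩ := hWb.exists_pos_norm_le
  have hexp (x : ℝ) (hx : x ≠ 0) (hxε : |x| < min ε (1 / r)) :
      1 / x ∉ W ∧ HasSum (fun n => P.coeff n * (|x| * x ^ n)) (g (1 / x)) := by
    rw [lt_min_iff, lt_div_iff₀ hr] at hxε
    constructor
    · intro hxW
      have hle := hrW _ hxW
      rw [Real.norm_eq_abs, abs_div, abs_one, div_le_iff₀ (abs_pos.2 hx)] at hle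
      linarith
    · rw [one_div, hgh x hx]
      have hsum := (hεP x (by simpa using hxε.1)).mul_left |x|
      simpa only [zero_add, smul_eq_mul, mul_comm (P.coeff _), mul_assoc] using hsum
  have hpos : 0 < min ε (1 / r) := by positivity
  refine ⟨hWc, hWb, hg, ⟨_, hpos, P.coeff, fun x hx hxε => ?_⟩,
    ⟨_, hpos, fun n => -P.coeff n, fun x hxε hx => ?_⟩⟩
  · simpa only [abs_of_pos hx, pow_succ'] using hexp x hx.ne' (by rwa [abs_of_pos hx])
  · simpa only [abs_of_neg hx, pow_succ', neg_mul, mul_neg] using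
      hexp x hx.ne (by rw [abs_of_neg hx]; linarith)

theorem IsSource.analyticAtInfinity_line {d : ℕ} {ν : Measure (Rn (d + 1))}
    {S W : Set (Rn (d + 1))} {ρ : Rn (d + 1) → ℝ} (h : IsSource ν S ρ) (hWc : IsClosed W)
    (hWb : Bornology.IsBounded W) (hs : ContDiffOn ℝ ∞ (ρ ⋆[lsmul ℝ ℝ, ν] invNorm) Wᶜ)
    (i : Fin (d + 1)) (q : Rn d) :
    AnalyticAtInfinity (lineSet i q W) (line i q (ρ ⋆[lsmul ℝ ℝ, ν] invNorm)) := by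
  have he : ‖EuclideanSpace.single i (1 : ℝ)‖ = 1 := by simp
  refine analyticAtInfinity_of_analyticAt (isClosed_lineSet i q hWc) (isBounded_lineSet i q hWb)
    (contDiffOn_line i q hs) (h.analyticAt_integral_inv_norm_add_smul he (ins i 0 q)) ?_
  intro x hx
  rw [← convolution_invNorm_add_inv_smul ν ρ _ _ hx, ins_add_smul_single, zero_add, line]

/-! ### Zeros of the derivatives of the kernel -/

section KernelZeros

open Polynomial

/-- The polynomial `P` of degree `k` for which `P u * (u² + 1) ^ (-1/2 - k)` is the `k`-th
derivative of `(u² + 1) ^ (-1/2)`. -/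
def invSqrtDerivNumer : ℕ → ℝ[X]
  | 0 => 1
  | k + 1 => derivative (invSqrtDerivNumer k) * (X ^ 2 + 1) -
      C (2 * k + 1 : ℝ) * X * invSqrtDerivNumer k

theorem natDegree_invSqrtDerivNumer_le (k : ℕ) : (invSqrtDerivNumer k).natDegree ≤ k := by
  induction k with
  | zero => rw [invSqrtDerivNumer, natDegree_one]
  | succ k ih =>
    rw [invSqrtDerivNumer]
    rcases Nat.eq_zero_or_pos k with rfl | hk
    · rw [invSqrtDerivNumer, derivative_one, zero_mul, zero_sub]
      compute_degree
    have hderiv : (derivative (invSqrtDerivNumer k)).natDegree ≤ k - 1 :=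
      (natDegree_derivative_le _).trans (Nat.sub_le_sub_right ih 1)
    have hquad : (X ^ 2 + 1 : ℝ[X]).natDegree ≤ 2 := by compute_degree
    have hlin : (C (2 * k + 1 : ℝ) * X : ℝ[X]).natDegree ≤ 1 := by compute_degree
    exact (natDegree_sub_le _ _).trans (max_le
      ((natDegree_mul_le_of_le hderiv hquad).trans (by omega))
      ((natDegree_mul_le_of_le hlin ih).trans (by omega)))

theorem coeff_invSqrtDerivNumer_self (k : ℕ) :
    (invSqrtDerivNumer k).coeff k = (-1) ^ k * k.factorial := by
  induction k with
  | zero => simp [invSqrtDerivNumer]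
  | succ k ih =>
    have htop : (invSqrtDerivNumer k).coeff (k + 1 + 1) = 0 :=
      coeff_eq_zero_of_natDegree_lt ((natDegree_invSqrtDerivNumer_le k).trans_lt (by omega))
    have hderiv : (derivative (invSqrtDerivNumer k) * X ^ 2).coeff (k + 1) =
        k * (invSqrtDerivNumer k).coeff k := by
      rcases k with _ | k
      · simp [invSqrtDerivNumer]
      · rw [coeff_mul_X_pow, coeff_derivative, Nat.cast_succ, mul_comm]
    rw [invSqrtDerivNumer, coeff_sub, mul_add, coeff_add, hderiv, mul_one, coeff_derivative, htop,
      mul_assoc, coeff_C_mul, coeff_X_mul, ih, pow_succ, Nat.factorial_succ]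
    push_cast
    ring

theorem invSqrtDerivNumer_ne_zero (k : ℕ) : invSqrtDerivNumer k ≠ 0 := by
  have hcoeff : (invSqrtDerivNumer k).coeff k ≠ 0 := by
    rw [coeff_invSqrtDerivNumer_self]
    positivity
  exact fun h => hcoeff (by rw [h, coeff_zero])

theorem iteratedDeriv_rpow_sq_add_one (k : ℕ) :
    iteratedDeriv k (fun u : ℝ => (u ^ 2 + 1) ^ (-(1 / 2) : ℝ)) =
      fun u => (invSqrtDerivNumer k).eval u * (u ^ 2 + 1) ^ (-(1 / 2) - k : ℝ) := by
  induction k with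
  | zero => simp [invSqrtDerivNumer]
  | succ k ih =>
    rw [iteratedDeriv_succ, ih]
    funext u
    have hpos : 0 < u ^ 2 + 1 := by positivity
    have hsq : HasDerivAt (fun u : ℝ => u ^ 2 + 1) (2 * u) u := by
      simpa using (hasDerivAt_pow 2 u).add_const 1
    have hprod := ((invSqrtDerivNumer k).hasDerivAt u).mul
      (hsq.rpow_const (p := -(1 / 2) - k) (Or.inl hpos.ne'))
    have hfactor : (u ^ 2 + 1) ^ (-(1 / 2) - k : ℝ) =
        (u ^ 2 + 1) * (u ^ 2 + 1) ^ (-(1 / 2) - k - 1 : ℝ) := by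
      rw [Real.rpow_sub_one hpos.ne', mul_div_cancel₀ _ hpos.ne']
    refine hprod.deriv.trans ?_
    rw [hfactor, invSqrtDerivNumer, Nat.cast_succ, ← sub_sub]
    simp only [eval_sub, eval_mul, eval_add, eval_pow, eval_X, eval_one, eval_C]
    ring

theorem contDiff_rpow_sq_add_one {n : WithTop ℕ∞} :
    ContDiff ℝ n (fun u : ℝ => (u ^ 2 + 1) ^ (-(1 / 2) : ℝ)) :=
  ContDiff.rpow_const_of_ne (by fun_prop) fun u => by positivity

variable {d : ℕ}

theorem line_invNorm (i : Fin (d + 1)) {w : Rn d} (hw : w ≠ 0) :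
    line i w invNorm = fun u => ‖w‖⁻¹ * ((‖w‖⁻¹ * u) ^ 2 + 1) ^ (-(1 / 2) : ℝ) := by
  funext u
  have hw' : 0 < ‖w‖ := norm_pos_iff.2 hw
  have hnorm : ‖ins i u w‖ = ‖w‖ * √((‖w‖⁻¹ * u) ^ 2 + 1) := by
    rw [← sq_eq_sq₀ (norm_nonneg _) (by positivity), norm_ins_sq, mul_pow,
      Real.sq_sqrt (by positivity)]
    field_simp
  rw [line, invNorm, hnorm, mul_inv, Real.rpow_neg (by positivity), Real.sqrt_eq_rpow]

theorem line_zero_invNorm (i : Fin (d + 1)) : line i 0 invNorm = fun u => |u|⁻¹ := by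
  funext u
  have hnorm : ‖ins i u (0 : Rn d)‖ = |u| := by
    rw [← sq_eq_sq₀ (norm_nonneg _) (abs_nonneg _), norm_ins_sq, norm_zero, sq_abs]
    ring
  rw [line, invNorm, hnorm]

theorem iteratedDeriv_inv_ne_zero (k : ℕ) {u : ℝ} (hu : u ≠ 0) :
    iteratedDeriv k (fun u : ℝ => u⁻¹) u ≠ 0 := by
  rw [iteratedDeriv_eq_iterate, iter_deriv_inv]
  have hfact : (k.factorial : ℝ) ≠ 0 := Nat.cast_ne_zero.2 k.factorial_ne_zero
  exact mul_ne_zero (mul_ne_zero (pow_ne_zero _ (by norm_num)) hfact) (zpow_ne_zero _ hu)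

theorem iteratedDeriv_inv_abs_ne_zero (k : ℕ) {u : ℝ} (hu : u ≠ 0) :
    iteratedDeriv k (fun u : ℝ => |u|⁻¹) u ≠ 0 := by
  rcases hu.lt_or_gt with hneg | hpos
  · have heq : (fun u : ℝ => |u|⁻¹) =ᶠ[nhds u] fun u => -u⁻¹ := by
      filter_upwards [gt_mem_nhds hneg] with v hv
      rw [abs_of_neg hv, inv_neg]
    rw [heq.iteratedDeriv_eq, iteratedDeriv_fun_neg]
    exact neg_ne_zero.2 (iteratedDeriv_inv_ne_zero k hu)
  · have heq : (fun u : ℝ => |u|⁻¹) =ᶠ[nhds u] fun u => u⁻¹ := by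
      filter_upwards [lt_mem_nhds hpos] with v hv
      rw [abs_of_pos hv]
    rw [heq.iteratedDeriv_eq]
    exact iteratedDeriv_inv_ne_zero k hu

theorem pderiv_iterate_invNorm_eq_zero_iff (i : Fin (d + 1)) (k : ℕ) (u : ℝ) {w : Rn d}
    (hw : w ≠ 0) :
    (pderiv i)^[k] invNorm (ins i u w) = 0 ↔ (invSqrtDerivNumer k).IsRoot (‖w‖⁻¹ * u) := by
  have hscale : ‖w‖⁻¹ ≠ 0 := inv_ne_zero (norm_ne_zero_iff.2 hw)
  have hpos : ((‖w‖⁻¹ * u) ^ 2 + 1) ^ (-(1 / 2) - k : ℝ) ≠ 0 := by positivity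
  change line i w ((pderiv i)^[k] invNorm) u = 0 ↔ _
  rw [← iteratedDeriv_line, line_invNorm i hw, iteratedDeriv_const_mul_field,
    iteratedDeriv_comp_const_mul contDiff_rpow_sq_add_one, iteratedDeriv_rpow_sq_add_one]
  simp only [mul_eq_zero, hscale, pow_ne_zero k hscale, hpos, false_or, or_false, IsRoot.def]

theorem pderiv_iterate_invNorm_ins_zero_ne_zero (i : Fin (d + 1)) (k : ℕ) {u : ℝ} (hu : u ≠ 0) :
    (pderiv i)^[k] invNorm (ins i u (0 : Rn d)) ≠ 0 := by
  change line i 0 ((pderiv i)^[k] invNorm) u ≠ 0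
  rw [← iteratedDeriv_line, line_zero_invNorm]
  exact iteratedDeriv_inv_abs_ne_zero k hu

theorem encard_zeros_pderiv_iterate_invNorm_le (i : Fin (d + 1)) (w : Rn d) (k : ℕ) :
    {u | ins i u w ≠ 0 ∧ (pderiv i)^[k] invNorm (ins i u w) = 0}.encard ≤ k := by
  rcases eq_or_ne w 0 with rfl | hw
  · have hempty : {u | ins i u (0 : Rn d) ≠ 0 ∧ (pderiv i)^[k] invNorm (ins i u (0 : Rn d)) = 0} =
        ∅ := by
      refine eq_empty_of_forall_notMem fun u ⟨hne, hzero⟩ => ?_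
      refine pderiv_iterate_invNorm_ins_zero_ne_zero i k (fun hu => hne ?_) hzero
      rw [← norm_eq_zero, ← sq_eq_zero_iff, norm_ins_sq, hu, norm_zero]
      ring
    rw [hempty, encard_empty]
    exact zero_le
  · have hinj : Function.Injective fun u => ‖w‖⁻¹ * u :=
      mul_right_injective₀ (inv_ne_zero (norm_ne_zero_iff.2 hw))
    have hroots : (fun u => ‖w‖⁻¹ * u) ''
        {u | ins i u w ≠ 0 ∧ (pderiv i)^[k] invNorm (ins i u w) = 0} ⊆
          ((invSqrtDerivNumer k).roots.toFinset : Set ℝ) := by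
      rintro _ ⟨u, ⟨-, hzero⟩, rfl⟩
      rw [pderiv_iterate_invNorm_eq_zero_iff i k u hw] at hzero
      exact Multiset.mem_toFinset.2 ((mem_roots (invSqrtDerivNumer_ne_zero k)).2 hzero)
    rw [← hinj.encard_image]
    refine (encard_le_encard hroots).trans ?_
    rw [encard_coe_eq_coe_finsetCard]
    exact_mod_cast (Multiset.toFinset_card_le _).trans
      ((card_roots' _).trans (natDegree_invSqrtDerivNumer_le k))

end KernelZeros

/-! ### Point charges -/

theorem isSource_dirac {X : Type*} [TopologicalSpace X] [T1Space X] [MeasurableSpace X]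
    [OpensMeasurableSpace X] (a : X) : IsSource (Measure.dirac a) {a} (1 : X → ℝ) where
  isCompact := isCompact_singleton
  integrable := integrable_const 1
  ae_mem := by simp only [ae_dirac_eq, Filter.eventually_pure, mem_singleton_iff, implies_true]

theorem dirac_convolution_invNorm {E : Type*} [NormedAddCommGroup E] [NormedSpace ℝ E]
    [MeasurableSpace E] [MeasurableSingletonClass E] (a : E) :
    1 ⋆[lsmul ℝ ℝ, Measure.dirac a] invNorm = fun p => 1 / ‖p - a‖ := by
  funext p
  rw [convolution_lsmul, integral_dirac, Pi.one_apply, one_smul, invNorm, one_div]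

theorem line_comp_sub_ins {d : ℕ} (i : Fin (d + 1)) (q b : Rn d) (s : ℝ) (φ : Rn (d + 1) → ℝ) :
    line i q (fun p => φ (p - ins i s b)) = fun t => line i (q - b) φ (t - s) := by
  funext t
  rw [line, ins_sub_ins, line]

theorem encard_zeros_line_point_le {d : ℕ} {a : Rn (d + 1)} {W : Set (Rn (d + 1))} (ha : a ∈ W)
    (i : Fin (d + 1)) (q : Rn d) (k : ℕ) :
    (zeros (lineSet i q W) (line i q fun p => 1 / ‖p - a‖) k).encard ≤ k := by
  obtain ⟨b, hb⟩ := exists_eq_ins i a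
  generalize a i = s at hb
  subst hb
  have hkernel : (fun p => 1 / ‖p - ins i s b‖) = fun p => invNorm (p - ins i s b) := by
    simp only [invNorm, one_div]
  rw [hkernel, line_comp_sub_ins]
  have hzeros : (fun t => t - s) ''
      zeros (lineSet i q W) (fun t => line i (q - b) invNorm (t - s)) k ⊆
        {u | ins i u (q - b) ≠ 0 ∧ (pderiv i)^[k] invNorm (ins i u (q - b)) = 0} := by
    rintro _ ⟨t, ⟨htW, hzero⟩, rfl⟩
    rw [iteratedDeriv_comp_sub_const, iteratedDeriv_line] at hzero
    refine ⟨fun hcenter => htW ?_, hzero⟩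
    rw [← ins_sub_ins, sub_eq_zero] at hcenter
    rwa [lineSet, mem_ofPred_eq, hcenter]
  rw [← (sub_left_injective (b := s)).encard_image]
  exact (encard_le_encard hzeros).trans (encard_zeros_pderiv_iterate_invNorm_le i (q - b) k)

theorem normal3_point (a : Rn 3) {s : ℝ} (hs : 0 < s) :
    Normal3 (closedBall a s) (fun p => 1 / ‖p - a‖) := by
  have haW : a ∈ closedBall a s := mem_closedBall_self hs.le
  have hsource := isSource_dirac a
  have hbase : Base3 (closedBall a s) (1 ⋆[lsmul ℝ ℝ, Measure.dirac a] invNorm) :=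
    hsource.base3_convolution isClosed_closedBall isBounded_closedBall
      (singleton_subset_iff.2 (ball_subset_interior_closedBall (mem_ball_self hs)))
  have hline := hsource.analyticAtInfinity_line hbase.isClosed hbase.isBounded hbase.smooth
  rw [dirac_convolution_invNorm] at hbase hline
  refine ⟨hbase, fun i c => ⟨hbase.base2_slice hline i c, 2, fun j e k hk => ?_⟩,
    4, fun i q k hk => ?_⟩
  · obtain ⟨q, -, hline_eq, hlineSet_eq⟩ := exists_line_slice_eq i j c (pt e)
    rw [hline_eq, hlineSet_eq]
    exact (encard_zeros_line_point_le haW _ q k).trans (by exact_mod_cast hk)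
  · exact (encard_zeros_line_point_le haW i q k).trans (by exact_mod_cast hk)

/-! ### Charges of constant sign -/

/-- The charge with density `ρ` with respect to `ν` is nowhere negative or nowhere positive, and its
total is nonzero. -/
def HasConstSign {X : Type*} [MeasurableSpace X] (ν : Measure X) (ρ : X → ℝ) : Prop :=
  ((∀ a, 0 ≤ ρ a) ∨ ∀ a, ρ a ≤ 0) ∧ ∫ a, ρ a ∂ν ≠ 0

section MeanValue

variable {X : Type*} [TopologicalSpace X] [MeasurableSpace X] {ν : Measure X} {S C : Set X}
  {ρ f : X → ℝ}

theorem IsSource.neg (h : IsSource ν S ρ) : IsSource ν S (-ρ) where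
  isCompact := h.isCompact
  integrable := h.integrable.neg
  ae_mem := h.ae_mem.mono fun _ ha hρ => ha (neg_ne_zero.1 hρ)

variable [T2Space X] [OpensMeasurableSpace X]

theorem IsSource.exists_integral_mul_eq_of_nonneg (h : IsSource ν S ρ) (hρ : ∀ a, 0 ≤ ρ a)
    (hSC : S ⊆ C) (hC : IsConnected C) (hCm : MeasurableSet C) (hf : ContinuousOn f C) :
    ∃ c ∈ C, ∫ a, ρ a * f a ∂ν = f c * ∫ a, ρ a ∂ν := by
  have hρC : ∀ᵐ a ∂ν, a ∉ C → ρ a = 0 :=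
    h.ae_mem.mono fun a ha haC => of_not_not fun hρ => haC (hSC (ha hρ))
  have hint : Integrable (fun a => f a * ρ a) ν := by
    simpa only [smul_eq_mul, mul_comm] using h.integrable_smul (hf.mono hSC)
  obtain ⟨c, hc, hmean⟩ := exists_eq_const_mul_setIntegral_of_ae_nonneg hC hCm hf
    h.integrable.integrableOn hint.integrableOn (ae_of_all _ hρ)
  rw [setIntegral_eq_integral_of_ae_compl_eq_zero hρC, setIntegral_eq_integral_of_ae_compl_eq_zero
    (hρC.mono fun a ha haC => by rw [ha haC, mul_zero])] at hmean
  exact ⟨c, hc, by simpa only [mul_comm] using hmean⟩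

theorem IsSource.exists_mem_eq_zero (h : IsSource ν S ρ) (hρ : HasConstSign ν ρ) (hSC : S ⊆ C)
    (hC : IsConnected C) (hCm : MeasurableSet C) (hf : ContinuousOn f C)
    (hzero : ∫ a, ρ a * f a ∂ν = 0) : ∃ c ∈ C, f c = 0 := by
  obtain ⟨hsign, htotal⟩ := hρ
  obtain ⟨c, hc, hmean⟩ : ∃ c ∈ C, ∫ a, ρ a * f a ∂ν = f c * ∫ a, ρ a ∂ν := by
    rcases hsign with hpos | hneg
    · exact h.exists_integral_mul_eq_of_nonneg hpos hSC hC hCm hf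
    · obtain ⟨c, hc, hmean⟩ := h.neg.exists_integral_mul_eq_of_nonneg
        (fun a => neg_nonneg.2 (hneg a)) hSC hC hCm hf
      simp only [Pi.neg_apply, neg_mul, integral_neg, mul_neg, neg_inj] at hmean
      exact ⟨c, hc, hmean⟩
  exact ⟨c, hc, (mul_eq_zero.1 (hmean.symm.trans hzero)).resolve_right htotal⟩

end MeanValue

theorem abs_sub_mul_norm_le {E : Type*} [SeminormedAddCommGroup E] {q b : E} {s α r : ℝ}
    (hs : |s| ≤ r) (hb : ‖b‖ ≤ r) : |s + α * ‖q - b‖ - α * ‖q‖| ≤ (1 + |α|) * r := by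
  have hdist : |‖q - b‖ - ‖q‖| ≤ r := by
    refine (abs_norm_sub_norm_le (q - b) q).trans ?_
    rwa [sub_sub_cancel_left, norm_neg]
  calc |s + α * ‖q - b‖ - α * ‖q‖| = |s + α * (‖q - b‖ - ‖q‖)| := by ring_nf
    _ ≤ |s| + |α| * |‖q - b‖ - ‖q‖| := by rw [← abs_mul]; exact abs_add_le _ _
    _ ≤ r + |α| * r := by gcongr
    _ = (1 + |α|) * r := by ring

section Zeros

variable {d : ℕ} {ν : Measure (Rn (d + 1))} {S : Set (Rn (d + 1))} {ρ : Rn (d + 1) → ℝ}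

theorem IsSource.exists_isRoot_of_iteratedDeriv_line_eq_zero (h : IsSource ν S ρ)
    (hρ : HasConstSign ν ρ) {r : ℝ} (hr0 : 0 ≤ r) (hr : S ⊆ closedBall 0 r) (i : Fin (d + 1))
    {q : Rn d} (hq : r < ‖q‖) {k : ℕ} {t : ℝ}
    (hzero : iteratedDeriv k (line i q (ρ ⋆[lsmul ℝ ℝ, ν] invNorm)) t = 0) :
    ∃ α, (invSqrtDerivNumer k).IsRoot α ∧ |t - α * ‖q‖| ≤ (1 + |α|) * r := by
  have hball : ins i t q ∉ closedBall (0 : Rn (d + 1)) r := by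
    rw [mem_closedBall_zero_iff, not_le]
    exact hq.trans_le (norm_le_norm_ins i t q)
  have hkernel := contDiffOn_pderiv_iterate isOpen_compl_singleton contDiffOn_invNorm i k
  rw [iteratedDeriv_line, line, h.pderiv_iterate_convolution contDiffOn_invNorm i k
    (notMem_subset hr hball)] at hzero
  -- Some unit point charge `a` in the ball has the same zero.
  obtain ⟨a, ha, hzero_a⟩ := h.exists_mem_eq_zero hρ hr
    ⟨nonempty_closedBall.2 hr0, (convex_closedBall _ _).isPreconnected⟩ measurableSet_closedBall
    (continuousOn_comp_const_sub hkernel.continuousOn hball) hzero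
  obtain ⟨b, hb⟩ := exists_eq_ins i a
  rw [mem_closedBall_zero_iff] at ha
  have hai : |a i| ≤ r := (abs_le_norm_ins i (a i) b).trans (hb ▸ ha)
  have hbr : ‖b‖ ≤ r := (norm_le_norm_ins i (a i) b).trans (hb ▸ ha)
  have hqb : q - b ≠ 0 := sub_ne_zero.2 fun heq => (heq ▸ hbr).not_gt hq
  rw [hb, ins_sub_ins, pderiv_iterate_invNorm_eq_zero_iff i k _ hqb] at hzero_a
  refine ⟨_, hzero_a, ?_⟩
  have ht : t = a i + ‖q - b‖⁻¹ * (t - a i) * ‖q - b‖ := by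
    rw [mul_right_comm, inv_mul_cancel₀ (norm_ne_zero_iff.2 hqb), one_mul, add_sub_cancel]
  calc _ = |a i + ‖q - b‖⁻¹ * (t - a i) * ‖q - b‖ - ‖q - b‖⁻¹ * (t - a i) * ‖q‖| := by rw [← ht]
    _ ≤ _ := abs_sub_mul_norm_le hai hbr

end Zeros

theorem exists_forall_isRoot_invSqrtDerivNumer_eq_or_eq_neg {k : ℕ} (hk : k ≤ 2) :
    ∃ A : ℝ, 0 ≤ A ∧ A ≤ 1 ∧ ∀ α, (invSqrtDerivNumer k).IsRoot α → α = A ∨ α = -A := by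
  interval_cases k
  · exact ⟨0, le_rfl, zero_le_one, fun α h => by simp [invSqrtDerivNumer] at h⟩
  · exact ⟨0, le_rfl, zero_le_one, fun α h => by simpa [invSqrtDerivNumer] using h⟩
  · refine ⟨√(1 / 2), Real.sqrt_nonneg _, Real.sqrt_le_one.2 (by norm_num), fun α h => ?_⟩
    have heval : (invSqrtDerivNumer 2).eval α = 2 * α ^ 2 - 1 := by
      simp only [invSqrtDerivNumer, Polynomial.derivative_one, Polynomial.derivative_neg,
        Polynomial.derivative_X, Polynomial.eval_sub, Polynomial.eval_neg, Polynomial.eval_one,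
        Polynomial.eval_mul, Polynomial.eval_add, Polynomial.eval_pow, Polynomial.eval_X,
        Polynomial.eval_C, zero_mul, zero_sub, mul_one, Nat.cast_zero, Nat.cast_one, mul_zero,
        zero_add, map_one, one_mul]
      ring
    rw [← sq_eq_sq_iff_eq_or_eq_neg, Real.sq_sqrt (by norm_num)]
    linarith [heval.symm.trans h]

theorem norm_pt (c : ℝ) : ‖pt c‖ = |c| := by
  simp [EuclideanSpace.norm_eq, pt, Real.sqrt_sq_eq_abs]

section QuasiNormal

variable {ν : Measure (Rn 3)} {S W : Set (Rn 3)} {ρ : Rn 3 → ℝ}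

theorem IsSource.zerosInIntervals (h : IsSource ν S ρ) (hρ : HasConstSign ν ρ) (W : Set (Rn 3)) :
    ZerosInIntervals W (ρ ⋆[lsmul ℝ ℝ, ν] invNorm) := by
  obtain ⟨r, hr0, hr⟩ := h.isCompact.isBounded.subset_closedBall_lt 0 0
  let roots : Finset ℝ := (Finset.range 5).biUnion fun k => (invSqrtDerivNumer k).roots.toFinset
  let α : Fin roots.card → ℝ := fun m => roots.equivFin.symm m
  refine ⟨r, ∑ m, 2 * ((1 + |α m|) * r), roots.card, fun i q hq =>
    ⟨fun m => α m * ‖q‖ - (1 + |α m|) * r, fun m => α m * ‖q‖ + (1 + |α m|) * r,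
      fun m => ?_, le_of_eq (Finset.sum_congr rfl fun m _ => by ring), ?_⟩⟩
  · have hradius : 0 ≤ (1 + |α m|) * r := by positivity
    linarith
  · rintro k hk t ⟨-, ht⟩
    obtain ⟨β, hβ, hβt⟩ := h.exists_isRoot_of_iteratedDeriv_line_eq_zero hρ hr0.le hr i hq ht
    have hmem : β ∈ roots := Finset.mem_biUnion.2 ⟨k, Finset.mem_range.2 (by omega),
      Multiset.mem_toFinset.2 ((Polynomial.mem_roots (invSqrtDerivNumer_ne_zero k)).2 hβ)⟩
    refine mem_iUnion.2 ⟨roots.equivFin ⟨β, hmem⟩, ?_⟩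
    have hα : α (roots.equivFin ⟨β, hmem⟩) = β := by simp [α]
    rw [abs_le] at hβt
    simp only [mem_Icc, hα]
    constructor <;> linarith [hβt.1, hβt.2]

theorem IsSource.quasiNormal2_slice (h : IsSource ν S ρ) (hρ : HasConstSign ν ρ)
    (hbase : Base3 W (ρ ⋆[lsmul ℝ ℝ, ν] invNorm)) (i : Fin 3) (c : ℝ) :
    QuasiNormal2 (sliceSet i c W) (slice i c (ρ ⋆[lsmul ℝ ℝ, ν] invNorm)) := by
  obtain ⟨r, hr0, hr⟩ := h.isCompact.isBounded.subset_closedBall_lt 0 0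
  refine ⟨hbase.base2_slice (h.analyticAtInfinity_line hbase.isClosed hbase.isBounded
    hbase.smooth) i c, r, 4 * r + 2, fun j e he k hk => ?_⟩
  obtain ⟨q, hqnorm, hline, hlineSet⟩ := exists_line_slice_eq i j c (pt e)
  obtain ⟨A, hA0, hA1, hA⟩ := exists_forall_isRoot_invSqrtDerivNumer_eq_or_eq_neg hk
  have hq : r < ‖q‖ := by
    rw [norm_pt, sq_abs] at hqnorm
    exact he.trans_le (abs_le_of_sq_le_sq (by nlinarith [sq_nonneg c]) (norm_nonneg _))
  have hAr : A * r ≤ r := mul_le_of_le_one_left hr0.le hA1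
  have hAr0 : 0 ≤ A * r := by positivity
  refine ⟨A * ‖q‖ + ((1 + A) * r + 1), A * ‖q‖ - ((1 + A) * r + 1), by linarith, by linarith, ?_⟩
  rw [hline, hlineSet]
  rintro t ⟨-, ht⟩
  obtain ⟨β, hβ, hβt⟩ := h.exists_isRoot_of_iteratedDeriv_line_eq_zero hρ hr0.le hr _ hq ht
  rw [abs_le] at hβt
  rcases hA β hβ with rfl | rfl
  · rw [abs_of_nonneg hA0] at hβt
    exact Or.inr ⟨by linarith [hβt.1], by linarith [hβt.2]⟩
  · rw [abs_neg, abs_of_nonneg hA0] at hβt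
    exact Or.inl ⟨by linarith [hβt.1], by linarith [hβt.2]⟩

theorem IsSource.quasiNormal3 (h : IsSource ν S ρ) (hρ : HasConstSign ν ρ) (hWc : IsClosed W)
    (hWb : Bornology.IsBounded W) (hW : S ⊆ interior W) :
    QuasiNormal3 W (ρ ⋆[lsmul ℝ ℝ, ν] invNorm) :=
  have hbase := h.base3_convolution hWc hWb hW
  ⟨hbase, h.quasiNormal2_slice hρ hbase, h.zerosInIntervals hρ W⟩

end QuasiNormal

/-! ### Potentials of continuous densities -/

theorem locallyIntegrable_invNorm {E : Type*} [NormedAddCommGroup E] [NormedSpace ℝ E]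
    [FiniteDimensional ℝ E] [MeasurableSpace E] [BorelSpace E] (μ : Measure E) [μ.IsAddHaarMeasure]
    (hE : 2 ≤ Module.finrank ℝ E) : LocallyIntegrable (invNorm (E := E)) μ := by
  have : Nontrivial E := Module.nontrivial_of_finrank_pos (R := ℝ) (by omega)
  have : ProperSpace E := FiniteDimensional.proper ℝ E
  rw [locallyIntegrable_iff]
  intro K hK
  obtain ⟨r, hr⟩ := hK.isBounded.subset_ball 0
  refine IntegrableOn.mono_set ?_ hr
  refine (integrableOn_fun_norm_addHaar μ (f := fun y : ℝ => y⁻¹)).2 ?_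
  have hpow : IntegrableOn (fun y : ℝ => y ^ (Module.finrank ℝ E - 2)) (Ioo 0 r) :=
    ((continuous_pow _).integrableOn_Icc (a := 0) (b := r)).mono_set Ioo_subset_Icc_self
  refine hpow.congr_fun (fun y hy => ?_) measurableSet_Ioo
  obtain ⟨n, hn⟩ := Nat.exists_eq_add_of_le' hE
  simp only [hn, Nat.add_sub_cancel, Nat.add_succ_sub_one, smul_eq_mul, pow_succ]
  rw [mul_inv_cancel_right₀ hy.1.ne']

theorem isSource_tsupport {X : Type*} [TopologicalSpace X] [MeasurableSpace X]
    [OpensMeasurableSpace X] {μ : Measure X} [IsFiniteMeasureOnCompacts μ] {ρ : X → ℝ}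
    (hc : Continuous ρ) (hs : HasCompactSupport ρ) : IsSource μ (tsupport ρ) ρ where
  isCompact := hs
  integrable := hc.integrable_of_hasCompactSupport hs
  ae_mem := ae_of_all _ fun _ hρ => subset_tsupport ρ hρ

theorem hasConstSign_of_continuous {X : Type*} [TopologicalSpace X] [MeasurableSpace X]
    [OpensMeasurableSpace X] {μ : Measure X} [μ.IsOpenPosMeasure] [IsFiniteMeasureOnCompacts μ]
    {ρ : X → ℝ} (hc : Continuous ρ) (hs : HasCompactSupport ρ)
    (hsign : (∀ a, 0 ≤ ρ a) ∨ ∀ a, ρ a ≤ 0) (h0 : ρ ≠ 0) : HasConstSign μ ρ := by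
  obtain ⟨a, ha⟩ := Function.ne_iff.1 h0
  refine ⟨hsign, ?_⟩
  rcases hsign with hpos | hneg
  · exact (hc.integral_pos_of_hasCompactSupport_nonneg_nonzero hs hpos ha).ne'
  · have hneg_int := hc.neg.integral_pos_of_hasCompactSupport_nonneg_nonzero (μ := μ) hs.neg
      (fun a => neg_nonneg.2 (hneg a)) (neg_ne_zero.2 ha)
    rw [integral_neg'] at hneg_int
    exact (neg_pos.1 hneg_int).ne

section Potential

variable {ρ ρ₁ ρ₂ : Rn 3 → ℝ}

theorem locallyIntegrable_invNorm_Rn_three : LocallyIntegrable (invNorm (E := Rn 3)) volume :=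
  locallyIntegrable_invNorm volume (by rw [finrank_euclideanSpace_fin]; norm_num)

theorem convolutionExists_invNorm (hc : Continuous ρ) (hs : HasCompactSupport ρ) :
    ConvolutionExists ρ invNorm (lsmul ℝ ℝ) volume :=
  hs.convolutionExists_left (lsmul ℝ ℝ) hc locallyIntegrable_invNorm_Rn_three

theorem integrable_div_norm_sub (hc : Continuous ρ) (hs : HasCompactSupport ρ) (p : Rn 3) :
    Integrable fun p' : Rn 3 => ρ p' / ‖p - p'‖ :=
  convolutionExists_invNorm hc hs p

theorem potential_add (hc₁ : Continuous ρ₁) (hs₁ : HasCompactSupport ρ₁) (hc₂ : Continuous ρ₂)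
    (hs₂ : HasCompactSupport ρ₂) : potential (ρ₁ + ρ₂) = potential ρ₁ + potential ρ₂ := by
  funext p
  exact (convolutionExists_invNorm hc₁ hs₁ p).add_distrib (convolutionExists_invNorm hc₂ hs₂ p)

theorem contDiff_potential (hc : ContDiff ℝ ∞ ρ) (hs : HasCompactSupport ρ) :
    ContDiff ℝ ∞ (potential ρ) := by
  rw [potential_eq_convolution]
  exact hs.contDiff_convolution_left (lsmul ℝ ℝ) hc locallyIntegrable_invNorm_Rn_three

theorem quasiNormal3_potential (hc : Continuous ρ) (hs : HasCompactSupport ρ)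
    (hsign : (∀ a, 0 ≤ ρ a) ∨ ∀ a, ρ a ≤ 0) (h0 : ρ ≠ 0) {W : Set (Rn 3)} (hWc : IsClosed W)
    (hWb : Bornology.IsBounded W) (hW : tsupport ρ ⊆ interior W) :
    QuasiNormal3 W (potential ρ) :=
  (isSource_tsupport hc hs).quasiNormal3 (hasConstSign_of_continuous hc hs hsign h0) hWc hWb hW

end Potential

/-! ### Charges of arbitrary sign -/

theorem ModerateDecrease.of_continuous {d n : ℕ} {W : Set (Rn d)} {f : Rn d → ℝ}
    (h : ModerateDecrease n W f) (hW : Bornology.IsBounded W) (hf : Continuous f) :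
    ModerateDecrease n ∅ f := by
  obtain ⟨C, hC, hbound⟩ := h
  obtain ⟨B, hB⟩ := hW.isCompact_closure.exists_bound_of_continuousOn
    (f := fun p => ‖p‖ ^ n * f p) (by fun_prop)
  refine ⟨max C B, lt_max_of_lt_left hC, fun p _ hp => ?_⟩
  have hnorm : 0 < ‖p‖ := zero_lt_one.trans hp
  rw [le_div_iff₀ (by positivity)]
  by_cases hpW : p ∈ W
  · refine le_trans (le_of_eq ?_) ((hB p (subset_closure hpW)).trans (le_max_right C B))
    rw [norm_mul, norm_pow, norm_norm, Real.norm_eq_abs, mul_comm]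
  · exact ((le_div_iff₀ (by positivity)).1 (hbound p hpW hp)).trans (le_max_left C B)

theorem Base3.of_contDiff {W : Set (Rn 3)} {f : Rn 3 → ℝ} (h : Base3 W f)
    (hf : ContDiff ℝ ∞ f) : Base3 ∅ f where
  isClosed := isClosed_empty
  isBounded := Bornology.isBounded_empty
  smooth := hf.contDiffOn
  decrease := h.decrease.of_continuous h.isBounded hf.continuous
  decrease_pderiv i j k hijk := by
    have h₂ := contDiffOn_pderiv_iterate isOpen_univ hf.contDiffOn 2 k
    have h₁ := contDiffOn_pderiv_iterate isOpen_univ h₂ 1 j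
    have h₀ := contDiffOn_pderiv_iterate isOpen_univ h₁ 0 i
    exact (h.decrease_pderiv i j k hijk).of_continuous h.isBounded
      (contDiffOn_univ.1 h₀).continuous

theorem exists_eq_add_nonneg_nonpos {X : Type*} [TopologicalSpace X] {ρ : X → ℝ}
    (hc : Continuous ρ) (hs : HasCompactSupport ρ) (h0 : ρ ≠ 0) :
    ∃ ρ₁ ρ₂ : X → ℝ, (Continuous ρ₁ ∧ HasCompactSupport ρ₁ ∧ (∀ a, 0 ≤ ρ₁ a) ∧ ρ₁ ≠ 0) ∧
      (Continuous ρ₂ ∧ HasCompactSupport ρ₂ ∧ (∀ a, ρ₂ a ≤ 0) ∧ ρ₂ ≠ 0) ∧ ρ = ρ₁ + ρ₂ := by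
  obtain ⟨a, ha⟩ := Function.ne_iff.1 h0
  have hpos : 0 < 2 * |ρ a| + ρ a := by linarith [abs_pos.2 ha, neg_abs_le (ρ a)]
  have hneg : -(2 * |ρ a|) < 0 := by linarith [abs_pos.2 ha]
  -- The factor `2` keeps both parts nonzero even when `ρ` itself has constant sign.
  refine ⟨fun x => 2 * |ρ x| + ρ x, fun x => -(2 * |ρ x|),
    ⟨by fun_prop, hs.comp_left (g := fun y => 2 * |y| + y) (by simp), fun x => ?_,
      Function.ne_iff.2 ⟨a, hpos.ne'⟩⟩,
    ⟨by fun_prop, hs.comp_left (g := fun y => -(2 * |y|)) (by simp), fun x => ?_,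
      Function.ne_iff.2 ⟨a, hneg.ne⟩⟩, ?_⟩
  · linarith [neg_abs_le (ρ x), abs_nonneg (ρ x)]
  · linarith [abs_nonneg (ρ x)]
  · funext x
    simp only [Pi.add_apply, add_neg_cancel_comm]

section Split

variable {ρ : Rn 3 → ℝ}

theorem base3_empty_potential (hc : ContDiff ℝ ∞ ρ) (hs : HasCompactSupport ρ) :
    Base3 ∅ (potential ρ) := by
  obtain ⟨r, hr⟩ := hs.isCompact.isBounded.subset_ball 0
  exact ((isSource_tsupport hc.continuous hs).base3_convolution isClosed_closedBall
    isBounded_closedBall (hr.trans ball_subset_interior_closedBall)).of_contDiff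
      (contDiff_potential hc hs)

theorem QuasiSplitNormal3.of_quasiNormal3 {W W' : Set (Rn 3)} {f f₁ f₂ : Rn 3 → ℝ}
    (hbase : Base3 W f) (hslice : ∀ i c, Base2 (sliceSet i c W) (slice i c f)) (hWW' : W ⊆ W')
    (h₁ : QuasiNormal3 W' f₁) (h₂ : QuasiNormal3 W' f₂) (hadd : ∀ p ∉ W', f p = f₁ p + f₂ p) :
    QuasiSplitNormal3 W f where
  toBase3 := hbase
  slice_quasiSplitNormal i c := ⟨hslice i c, sliceSet i c W', slice i c f₁, slice i c f₂,
    fun _ hq => hWW' hq, h₁.slice_quasiNormal i c, h₂.slice_quasiNormal i c,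
    fun _ hq => hadd _ hq⟩
  split := ⟨W', f₁, f₂, hWW', h₁.isClosed, h₁.isBounded, h₁.smooth, h₂.smooth, h₁.zeros_subset,
    h₂.zeros_subset, hadd⟩

theorem quasiSplitNormal3_potential (hc : ContDiff ℝ ∞ ρ) (hs : HasCompactSupport ρ)
    (h0 : ρ ≠ 0) : QuasiSplitNormal3 ∅ (potential ρ) := by
  have hbase := base3_empty_potential hc hs
  have hline := (isSource_tsupport hc.continuous hs).analyticAtInfinity_line hbase.isClosed
    hbase.isBounded hbase.smooth
  obtain ⟨ρ₁, ρ₂, ⟨hc₁, hs₁, hsign₁, h0₁⟩, ⟨hc₂, hs₂, hsign₂, h0₂⟩, rfl⟩ :=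
    exists_eq_add_nonneg_nonpos hc.continuous hs h0
  obtain ⟨r, hr⟩ := (hs₁.isCompact.isBounded.union hs₂.isCompact.isBounded).subset_ball 0
  obtain ⟨hr₁, hr₂⟩ := union_subset_iff.1 (hr.trans ball_subset_interior_closedBall)
  have hquasi₁ := quasiNormal3_potential hc₁ hs₁ (Or.inl hsign₁) h0₁ isClosed_closedBall
    isBounded_closedBall hr₁
  have hquasi₂ := quasiNormal3_potential hc₂ hs₂ (Or.inr hsign₂) h0₂ isClosed_closedBall
    isBounded_closedBall hr₂
  exact .of_quasiNormal3 hbase (hbase.base2_slice hline) (empty_subset _) hquasi₁ hquasi₂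
    fun p _ => congrFun (potential_add hc₁ hs₁ hc₂ hs₂) p

end Split

end

end Normality

theorem mainTheorem5 :
    (∀ (a : Normality.Rn 3) (s : ℝ), 0 < s →
      Normality.Normal3 (Metric.closedBall a s) (fun p => 1 / ‖p - a‖)) ∧
    (∀ ρ : Normality.Rn 3 → ℝ, Continuous ρ → HasCompactSupport ρ → (∀ p, 0 ≤ ρ p) → ρ ≠ 0 →
      (∀ p, MeasureTheory.Integrable (fun p' : Normality.Rn 3 => ρ p' / ‖p - p'‖)) ∧
      ∀ W : Set (Normality.Rn 3), IsClosed W → Bornology.IsBounded W → tsupport ρ ⊆ interior W →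
        Normality.QuasiNormal3 W (Normality.potential ρ)) ∧
    (∀ ρ : Normality.Rn 3 → ℝ, ContDiff ℝ ∞ ρ → HasCompactSupport ρ → ρ ≠ 0 →
      (∀ p, MeasureTheory.Integrable (fun p' : Normality.Rn 3 => ρ p' / ‖p - p'‖)) ∧
      Normality.QuasiSplitNormal3 ∅ (Normality.potential ρ)) := by
  refine ⟨fun a s hs => Normality.normal3_point a hs, fun ρ hc hs hn h0 => ⟨?_, ?_⟩,
    fun ρ hc hs h0 => ⟨?_, ?_⟩⟩
  · exact Normality.integrable_div_norm_sub hc hs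
  · exact fun W hWc hWb hW => Normality.quasiNormal3_potential hc hs (Or.inl hn) h0 hWc hWb hW
  · exact Normality.integrable_div_norm_sub hc.continuous hs
  · exact Normality.quasiSplitNormal3_potential hc hs h0
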